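/- Let $E$ and $F$ be $n$-dimensional complex vector spaces with fixed bases $e_1,\dots,e_n$ and $f_1,\dots,f_n$, and let $\pi$ be a partition of $n$ with a Young tableau $\bar\pi$ of shape $\pi$. Let $c_{\bar\pi}=\sum_{p,q}\operatorname{sgn}(q)\,pq\in\mathbb{C}\mathfrak{S}_n$ be its Young symmetrizer ($p$ preserves the rows of $\bar\pi$, $q$ the columns). Let $[\pi]=\mathbb{C}\mathfrak{S}_n\,c_{\bar\pi}$ be the corresponding irreducible representation of $\mathfrak{S}_n$, with character $\chi_\pi$, and let $S_\pi(E)=E^{\otimes n}c_{\bar\pi}$, $S_\pi(F)=F^{\otimes n}c_{\bar\pi}$ be the corresponding representations of $GL(E)$, $GL(F)$, where $\mathfrak{S}_n$ acts on the right of a tensor power by permuting the factors. For a representation $V$ of $GL(E)$ let $V_0$ be its weight-zero subspace, that is, the vectors fixed by all elements of $SL(E)$ that are diagonal in the basis $(e_i)$; similarly for $F$. Let $\sigma\in\mathfrak{S}_n$ act on $S^n(E\otimes F)$ through $e_i\mapsto e_{\sigma(i)}$, $f_j\mapsto f_{\sigma(j)}$. Identify elements of $S^n(E\otimes F)$ with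 homogeneous polynomials of degree $n$ in variables $x_{ij}$ through $e_i\otimes f_j\leftrightarrow x_{ij}$. The immanant is $$P_\pi=\sum_{\sigma\in\mathfrak{S}_n}\chi_\pi(\sigma)\prod_{i=1}^n e_i\otimes f_{\sigma(i)}\in S^n(E\otimes F),\qquad\text{i.e.}\qquad P_\pi=\sum_{\sigma\in\mathfrak{S}_n}\chi_\pi(\sigma)\prod_{i=1}^n x_{i\sigma(i)}.$$ Then $S^n(E\otimes F)$ contains exactly one $GL(E)\times GL(F)$-subrepresentation $U_\pi$ isomorphic to $S_\pi(E)\otimes S_\pi(F)$ (the summand belonging to $\pi$ in the Cauchy decomposition of $S^n(E\otimes F)$). Under any isomorphism $S_\pi(E)\otimes S_\pi(F)\cong U_\pi$, the image of $(S_\pi(E))_0\otimes(S_\pi(F))_0$ contains exactly one copy $\mathbb{C}_\pi$ of the trivial representation of $\mathfrak{S}_n$, and this copy does not depend on the isomorphism. Moreover $$P_\pi\in\mathbb{C}_\pi ,$$ in particular $P_\pi\in U_\pi$, and $P_\pi$ is the only element of $\mathbb{C}_\pi$ whose value, as a polynomial, at the identity matrix is $\dim[\pi]$. -/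

import Mathlib

open scoped TensorProduct

noncomputable section

namespace Immanant

/-! ### Young tableaux, Young symmetrizers, Specht modules

A partition of `n` is a Young diagram `μ` with `n` cells, and a Young tableau of shape `μ` is a
bijection `T : Fin n ≃ μ.cells`.  A cell is a pair (row, column). -/

section Young

variable {n : ℕ} {μ : YoungDiagram}

/-- The group of permutations that preserve each row of the tableau `T`. -/
def rowStabilizer (T : Fin n ≃ μ.cells) : Subgroup (Equiv.Perm (Fin n)) where
  carrier := {σ | ∀ i, (T (σ i)).1.1 = (T i).1.1}
  mul_mem' := fun {a b} ha hb i => (ha (b i)).trans (hb i)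
  one_mem' := fun _ => rfl
  inv_mem' := fun {a} ha i => by
    have h := ha (a⁻¹ i)
    rw [← Equiv.Perm.mul_apply, mul_inv_cancel, Equiv.Perm.one_apply] at h
    exact h.symm

/-- The group of permutations that preserve each column of the tableau `T`. -/
def colStabilizer (T : Fin n ≃ μ.cells) : Subgroup (Equiv.Perm (Fin n)) where
  carrier := {σ | ∀ i, (T (σ i)).1.2 = (T i).1.2}
  mul_mem' := fun {a b} ha hb i => (ha (b i)).trans (hb i)
  one_mem' := fun _ => rfl
  inv_mem' := fun {a} ha i => by
    have h := ha (a⁻¹ i)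
    rw [← Equiv.Perm.mul_apply, mul_inv_cancel, Equiv.Perm.one_apply] at h
    exact h.symm

open Classical in
/-- The Young symmetrizer `∑ sgn(q) p q`, over `p` in the row group and `q` in the column group. -/
def youngSymmetrizer (T : Fin n ≃ μ.cells) : MonoidAlgebra ℂ (Equiv.Perm (Fin n)) :=
  ∑ p : rowStabilizer T, ∑ q : colStabilizer T,
    MonoidAlgebra.single ((p : Equiv.Perm (Fin n)) * (q : Equiv.Perm (Fin n)))
      (((Equiv.Perm.sign (q : Equiv.Perm (Fin n)) : ℤˣ) : ℤ) : ℂ)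

/-- The left regular representation of the symmetric group on its group algebra. -/
def regularRep (n : ℕ) :
    Representation ℂ (Equiv.Perm (Fin n)) (MonoidAlgebra ℂ (Equiv.Perm (Fin n))) :=
  (Algebra.lmul ℂ (MonoidAlgebra ℂ (Equiv.Perm (Fin n)))).toMonoidHom.comp
    (MonoidAlgebra.of ℂ (Equiv.Perm (Fin n)))

/-- The irreducible representation of the symmetric group attached to the shape of `T`: the left
ideal generated by the Young symmetrizer. -/
def specht (T : Fin n ≃ μ.cells) : Subrepresentation (regularRep n) where
  toSubmodule := LinearMap.range (LinearMap.mulRight ℂ (youngSymmetrizer T))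
  apply_mem_toSubmodule := by
    rintro g _ ⟨x, rfl⟩
    exact ⟨MonoidAlgebra.of ℂ _ g * x, by simp [regularRep, mul_assoc]⟩

/-- The irreducible character of the symmetric group attached to the shape of `T`. -/
def spechtCharacter (T : Fin n ≃ μ.cells) (σ : Equiv.Perm (Fin n)) : ℂ :=
  (specht T).toRepresentation.character σ

end Young

/-! ### Tensor powers and Schur modules -/

section Schur

variable {n : ℕ} {μ : YoungDiagram} (E : Type*) [AddCommGroup E] [Module ℂ E]

/-- The natural representation of `GL(E)` on `E`. -/
def naturalRep : Representation ℂ (LinearMap.GeneralLinearGroup ℂ E) E :=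
  Units.coeHom (Module.End ℂ E)

/-- The representation of `GL(E)` on the tensor power `E^{⊗ n}`. -/
def tensorPowerRep (n : ℕ) :
    Representation ℂ (LinearMap.GeneralLinearGroup ℂ E) (⨂[ℂ] _ : Fin n, E) where
  toFun g := PiTensorProduct.map fun _ => naturalRep E g
  map_one' := by
    simp only [map_one]
    exact PiTensorProduct.map_one
  map_mul' g h := by
    simp only [map_mul]
    exact PiTensorProduct.map_mul _ _

/-- The right action of a permutation on the tensor power by permuting the factors,
`(v₁ ⊗ ⋯ ⊗ vₙ) · σ = v_{σ(1)} ⊗ ⋯ ⊗ v_{σ(n)}`. -/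
def placePerm (σ : Equiv.Perm (Fin n)) : (⨂[ℂ] _ : Fin n, E) →ₗ[ℂ] (⨂[ℂ] _ : Fin n, E) :=
  (PiTensorProduct.reindex ℂ (fun _ : Fin n => E) σ.symm).toLinearMap

/-- The right action of an element of the group algebra on the tensor power. -/
def placeAction (a : MonoidAlgebra ℂ (Equiv.Perm (Fin n))) :
    (⨂[ℂ] _ : Fin n, E) →ₗ[ℂ] (⨂[ℂ] _ : Fin n, E) :=
  ∑ σ : Equiv.Perm (Fin n), a.coeff σ • placePerm E σ

variable {E} in
theorem placePerm_tprod (σ : Equiv.Perm (Fin n)) (v : Fin n → E) :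
    placePerm E σ (PiTensorProduct.tprod ℂ v) = PiTensorProduct.tprod ℂ fun i => v (σ i) := by
  simp [placePerm, PiTensorProduct.reindex_tprod]

theorem tensorPowerRep_placePerm (g : LinearMap.GeneralLinearGroup ℂ E)
    (σ : Equiv.Perm (Fin n)) (x : ⨂[ℂ] _ : Fin n, E) :
    tensorPowerRep E n g (placePerm E σ x) = placePerm E σ (tensorPowerRep E n g x) := by
  have h : (tensorPowerRep E n g) ∘ₗ (placePerm E σ)
      = (placePerm E σ) ∘ₗ (tensorPowerRep E n g) := by
    ext v
    simp only [LinearMap.compMultilinearMap_apply, LinearMap.comp_apply, placePerm_tprod]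
    simp only [tensorPowerRep, MonoidHom.coe_mk, OneHom.coe_mk, PiTensorProduct.map_tprod,
      placePerm_tprod]
  exact LinearMap.congr_fun h x

/-- The Schur module of `E`: the image of the Young symmetrizer in the tensor power, as a
representation of `GL(E)`. -/
def schur (T : Fin n ≃ μ.cells) : Subrepresentation (tensorPowerRep E n) where
  toSubmodule := LinearMap.range (placeAction E (youngSymmetrizer T))
  apply_mem_toSubmodule := by
    rintro g _ ⟨x, rfl⟩
    refine ⟨tensorPowerRep E n g x, ?_⟩
    simp [placeAction, LinearMap.sum_apply, tensorPowerRep_placePerm]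

variable {E}

/-- The diagonal element of `GL(E)` with eigenvalue `a i` on the basis vector `e i`. -/
def diagonal (e : Module.Basis (Fin n) ℂ E) (a : Fin n → ℂˣ) :
    LinearMap.GeneralLinearGroup ℂ E :=
  LinearMap.GeneralLinearGroup.ofLinearEquiv (e.equiv (e.unitsSMul a) (Equiv.refl _))

/-- The element of `GL(E)` that permutes the basis by `e i ↦ e (σ i)`. -/
def permutation (e : Module.Basis (Fin n) ℂ E) (σ : Equiv.Perm (Fin n)) :
    LinearMap.GeneralLinearGroup ℂ E :=
  LinearMap.GeneralLinearGroup.ofLinearEquiv (e.equiv e σ)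

theorem diagonal_apply (e : Module.Basis (Fin n) ℂ E) (a : Fin n → ℂˣ) (i : Fin n) :
    naturalRep E (diagonal e a) (e i) = (a i : ℂ) • e i := by
  change (e.equiv (e.unitsSMul a) (Equiv.refl _)) (e i) = _
  simp [Module.Basis.unitsSMul_apply, Units.smul_def]

theorem permutation_apply (e : Module.Basis (Fin n) ℂ E) (σ : Equiv.Perm (Fin n)) (i : Fin n) :
    naturalRep E (permutation e σ) (e i) = e (σ i) := by
  change (e.equiv e σ) (e i) = _
  simp

theorem permutation_one (e : Module.Basis (Fin n) ℂ E) : permutation e 1 = 1 :=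
  Units.ext <| e.ext fun i => permutation_apply e 1 i

theorem permutation_mul (e : Module.Basis (Fin n) ℂ E) (σ τ : Equiv.Perm (Fin n)) :
    permutation e (σ * τ) = permutation e σ * permutation e τ :=
  Units.ext <| e.ext fun i => (permutation_apply e (σ * τ) i).trans
    (((congrArg (naturalRep E (permutation e σ)) (permutation_apply e τ i)).trans
      (permutation_apply e σ (τ i))).symm)

/-- The weight-zero subspace of a representation of `GL(E)`, with respect to `SL(E)`: the vectors
fixed by the maximal torus of `SL(E)`, that is, by all diagonal matrices of determinant one. -/
def weightZero (e : Module.Basis (Fin n) ℂ E) {V : Type*} [AddCommGroup V] [Module ℂ V]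
    (ρ : Representation ℂ (LinearMap.GeneralLinearGroup ℂ E) V) : Submodule ℂ V where
  carrier := {v | ∀ a : Fin n → ℂˣ, ∏ i, a i = 1 → ρ (diagonal e a) v = v}
  add_mem' := fun hv hw a ha => by rw [map_add, hv a ha, hw a ha]
  zero_mem' := fun _ _ => map_zero _
  smul_mem' := fun c _ hv a ha => by rw [map_smul, hv a ha]

end Schur

/-! ### Symmetric powers -/

section SymmetricPower

variable {n : ℕ} {M N : Type*} [AddCommGroup M] [Module ℂ M] [AddCommGroup N] [Module ℂ N]

/-- The linear map on the symmetric power induced by a symmetric multilinear map. -/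
def symLift (f : MultilinearMap ℂ (fun _ : Fin n => M) N)
    (hf : ∀ (σ : Equiv.Perm (Fin n)) (v : Fin n → M), f (fun i => v (σ i)) = f v) :
    Sym[ℂ]^n M →ₗ[ℂ] N where
  toFun := AddCon.lift _ (PiTensorProduct.lift f).toAddMonoidHom (by
    refine AddCon.addConGen_le.2 ?_
    rintro _ _ ⟨σ, v⟩
    simp [hf])
  map_add' := map_add _
  map_smul' c x := by
    induction x using AddCon.induction_on with
    | H x => exact (PiTensorProduct.lift f).map_smul c x

@[simp]
theorem symLift_tprod (f : MultilinearMap ℂ (fun _ : Fin n => M) N)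
    (hf : ∀ (σ : Equiv.Perm (Fin n)) (v : Fin n → M), f (fun i => v (σ i)) = f v)
    (v : Fin n → M) : symLift f hf (SymmetricPower.tprod ℂ v) = f v :=
  PiTensorProduct.lift.tprod v

theorem sym_ext {f g : Sym[ℂ]^n M →ₗ[ℂ] N}
    (h : ∀ v : Fin n → M, f (SymmetricPower.tprod ℂ v) = g (SymmetricPower.tprod ℂ v)) :
    f = g := by
  refine LinearMap.ext_on (SymmetricPower.span_tprod_eq_top (R := ℂ) (ι := Fin n) (M := M)) ?_
  rintro _ ⟨v, rfl⟩
  exact h v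

/-- The endomorphism `v₁ ⋯ vₙ ↦ g v₁ ⋯ g vₙ` of the symmetric power. -/
def symMap (n : ℕ) (g : Module.End ℂ M) : Module.End ℂ (Sym[ℂ]^n M) :=
  symLift ((SymmetricPower.tprod ℂ).compLinearMap fun _ => g)
    (fun σ v => SymmetricPower.tprod_equiv σ fun i => g (v i))

@[simp]
theorem symMap_tprod (g : Module.End ℂ M) (v : Fin n → M) :
    symMap n g (SymmetricPower.tprod ℂ v) = SymmetricPower.tprod ℂ fun i => g (v i) :=
  symLift_tprod _ _ v

/-- The symmetric power of a representation. -/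
def symPowerRep {G : Type*} [Monoid G] (n : ℕ) (ρ : Representation ℂ G M) :
    Representation ℂ G (Sym[ℂ]^n M) where
  toFun g := symMap n (ρ g)
  map_one' := sym_ext fun v => by simp
  map_mul' g h := sym_ext fun v => by simp

end SymmetricPower

/-! ### The representations of `GL(E) × GL(F)` and the immanant -/

section Main

variable {n : ℕ} {μ : YoungDiagram} {E F : Type*} [AddCommGroup E] [Module ℂ E]
  [AddCommGroup F] [Module ℂ F]

/-- The external tensor product of representations of two groups. -/
def externalTensor {G H V W : Type*} [Monoid G] [Monoid H] [AddCommMonoid V] [Module ℂ V]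
    [AddCommMonoid W] [Module ℂ W] (ρ : Representation ℂ G V) (τ : Representation ℂ H W) :
    Representation ℂ (G × H) (V ⊗[ℂ] W) :=
  Representation.tprod (ρ.comp (MonoidHom.fst G H)) (τ.comp (MonoidHom.snd G H))

/-- `S^n(E ⊗ F)` as a representation of `GL(E) × GL(F)`. -/
def symTensorRep (n : ℕ) (E F : Type*) [AddCommGroup E] [Module ℂ E] [AddCommGroup F]
    [Module ℂ F] :
    Representation ℂ (LinearMap.GeneralLinearGroup ℂ E × LinearMap.GeneralLinearGroup ℂ F)
      (Sym[ℂ]^n (E ⊗[ℂ] F)) :=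
  symPowerRep n (externalTensor (naturalRep E) (naturalRep F))

/-- The diagonal action of the symmetric group on `S^n(E ⊗ F)`:
`σ` permutes both bases, `σ (e i ⊗ f j) = e (σ i) ⊗ f (σ j)`. -/
def permRep (e : Module.Basis (Fin n) ℂ E) (f : Module.Basis (Fin n) ℂ F) :
    Representation ℂ (Equiv.Perm (Fin n)) (Sym[ℂ]^n (E ⊗[ℂ] F)) where
  toFun σ := symTensorRep n E F (permutation e σ, permutation f σ)
  map_one' := by rw [permutation_one, permutation_one, Prod.mk_one_one, map_one]
  map_mul' σ τ := by rw [permutation_mul, permutation_mul, ← Prod.mk_mul_mk, map_mul]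

/-- The subrepresentation `U` of `ρ` is isomorphic to the representation `τ`. -/
def IsCopyOf {G V W : Type*} [Monoid G] [AddCommMonoid V] [Module ℂ V] [AddCommMonoid W]
    [Module ℂ W] (τ : Representation ℂ G W) {ρ : Representation ℂ G V} (U : Subrepresentation ρ) : Prop :=
  Nonempty (τ.Equiv U.toRepresentation)

/-- The representation `S_π(E) ⊗ S_π(F)` of `GL(E) × GL(F)`. -/
def schurTensor (E F : Type*) [AddCommGroup E] [Module ℂ E] [AddCommGroup F] [Module ℂ F]
    (T : Fin n ≃ μ.cells) :
    Representation ℂ (LinearMap.GeneralLinearGroup ℂ E × LinearMap.GeneralLinearGroup ℂ F)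
      ((schur E T).toSubmodule ⊗[ℂ] (schur F T).toSubmodule) :=
  externalTensor (schur E T).toRepresentation (schur F T).toRepresentation

/-- The subspace `S_π(E)_0 ⊗ S_π(F)_0` of `S_π(E) ⊗ S_π(F)`. -/
def weightZeroTensor (e : Module.Basis (Fin n) ℂ E) (f : Module.Basis (Fin n) ℂ F)
    (T : Fin n ≃ μ.cells) :
    Submodule ℂ ((schur E T).toSubmodule ⊗[ℂ] (schur F T).toSubmodule) :=
  LinearMap.range (TensorProduct.mapIncl
    (weightZero e (schur E T).toRepresentation) (weightZero f (schur F T).toRepresentation))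

/-- The image of `S_π(E)_0 ⊗ S_π(F)_0` in `S^n(E ⊗ F)` when `S_π(E) ⊗ S_π(F)` is identified with
a subrepresentation `U` of `S^n(E ⊗ F)` by `φ`. -/
def weightZeroImage (e : Module.Basis (Fin n) ℂ E) (f : Module.Basis (Fin n) ℂ F)
    (T : Fin n ≃ μ.cells) (U : Subrepresentation (symTensorRep n E F))
    (φ : (schurTensor E F T).Equiv U.toRepresentation) : Submodule ℂ (Sym[ℂ]^n (E ⊗[ℂ] F)) :=
  (weightZeroTensor e f T).map (U.toSubmodule.subtype ∘ₗ φ.toLinearMap)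

/-- The immanant as a polynomial in the variables `x_{ij}`. -/
def immanantPoly (T : Fin n ≃ μ.cells) : MvPolynomial (Fin n × Fin n) ℂ :=
  ∑ σ : Equiv.Perm (Fin n),
    MvPolynomial.C (spechtCharacter T σ) * ∏ i : Fin n, MvPolynomial.X (i, σ i)

/-- The immanant as an element of `S^n(E ⊗ F)`. -/
def immanant (e : Module.Basis (Fin n) ℂ E) (f : Module.Basis (Fin n) ℂ F)
    (T : Fin n ≃ μ.cells) : Sym[ℂ]^n (E ⊗[ℂ] F) :=
  ∑ σ : Equiv.Perm (Fin n),
    spechtCharacter T σ • SymmetricPower.tprod ℂ fun i : Fin n => e i ⊗ₜ[ℂ] f (σ i)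

/-- The polynomial in the variables `x_{ij}` that corresponds to an element of `S^n(E ⊗ F)` under
the identification of `e i ⊗ f j` with `x_{ij}`. -/
def toPoly (e : Module.Basis (Fin n) ℂ E) (f : Module.Basis (Fin n) ℂ F) :
    Sym[ℂ]^n (E ⊗[ℂ] F) →ₗ[ℂ] MvPolynomial (Fin n × Fin n) ℂ :=
  symLift
    ((MultilinearMap.mkPiAlgebra ℂ (Fin n) (MvPolynomial (Fin n × Fin n) ℂ)).compLinearMap
      fun _ => (e.tensorProduct f).constr ℂ fun ij => MvPolynomial.X ij)
    (fun σ v => by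
      simp only [MultilinearMap.compLinearMap_apply, MultilinearMap.mkPiAlgebra_apply]
      exact Equiv.prod_comp σ
        fun i => (e.tensorProduct f).constr ℂ (fun ij => MvPolynomial.X ij) (v i))

/-- The two descriptions of the immanant agree. -/
theorem toPoly_immanant (e : Module.Basis (Fin n) ℂ E) (f : Module.Basis (Fin n) ℂ F)
    (T : Fin n ≃ μ.cells) : toPoly e f (immanant e f T) = immanantPoly T := by
  have h : ∀ i j, (e.tensorProduct f).constr ℂ
      (fun ij => (MvPolynomial.X ij : MvPolynomial (Fin n × Fin n) ℂ)) (e i ⊗ₜ[ℂ] f j)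
        = MvPolynomial.X (i, j) := fun i j => by
    rw [← Module.Basis.tensorProduct_apply, Module.Basis.constr_basis]
  simp [immanant, immanantPoly, toPoly, h, MvPolynomial.smul_eq_C_mul]

/-- The value of an element of `S^n(E ⊗ F)`, seen as a polynomial on `n × n` matrices, at the
identity matrix. -/
def evalIdentity (e : Module.Basis (Fin n) ℂ E) (f : Module.Basis (Fin n) ℂ F)
    (Q : Sym[ℂ]^n (E ⊗[ℂ] F)) : ℂ :=
  MvPolynomial.eval (fun ij : Fin n × Fin n => (1 : Matrix (Fin n) (Fin n) ℂ) ij.1 ij.2)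
    (toPoly e f Q)

end Main

end Immanant

end

noncomputable section

namespace Immanant

/-! ### Combinatorics of tableaux: factoring a permutation into a row part and a column part. -/

section YoungLemma

variable {n : ℕ} {μ : YoungDiagram}

/-! Let A be the group algebra of 𝔖ₙ, R = `rowSum T`, C = `colSum T`, c = RC the Young symmetrizer,
and * the inversion of permutations, so that c* = CR. The theorem is reduced to computations in A.
The pairing `symPairing` of E^{⊗n} and F^{⊗n}, which sends (v₁ ⊗ ⋯ ⊗ vₙ, w₁ ⊗ ⋯ ⊗ wₙ) to ∏ vᵢ ⊗ wᵢ,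
is equivariant, and an element a of A moves from one argument to the other as a*. Its restriction to
the Schur modules is `schurPairing`, and U_π is the range.

The engine is von Neumann's lemma RAC = ℂc (`rowSum_mul_colSum`). It gives cσc = t_σ c with t_σ
real, c² = tc with t ≠ 0, and cAc* = ℂcc*.

Uniqueness of U_π: an equivariant map S_π(E) ⊗ S_π(F) → Sⁿ(E ⊗ F), pulled back to tensor powers, is
determined by its value at (e₁ ⊗ ⋯ ⊗ eₙ, f₁ ⊗ ⋯ ⊗ fₙ), since the ordered bases form one GL-orbit and
determine a multilinear map. This value is fixed by both tori, so the pullback is (x, y) ↦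
`symPairing` of x and y·a for some a in A. Since cac* is a multiple of cc*, the map is a multiple of
`schurPairing` (`exists_eq_smul_schurPairing`). The pairing is injective because polarization
followed by c ⊗ c multiplies by ∑ t_σ² > 0.

The line ℂ_π: weight-zero vectors of S_π(E) are (e₁ ⊗ ⋯ ⊗ eₙ)·ac, so S_π(E)₀ ⊗ S_π(F)₀ maps onto the
span of the elements bcc*a* of A, seen in Sⁿ(E ⊗ F) through `orbitMap`. There 𝔖ₙ acts by
conjugation, and the sum of the conjugates of bcc*a* is a multiple of that of c
(`exists_conjSum_eq_smul`). A trace computation identifies the latter with tχ_π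
(`smul_characterSum`), that is, with a nonzero multiple of the immanant. At the identity matrix only
σ = 1 contributes, which normalizes the generator. -/

/-- The number of entries of a row of `T` in the first `k` columns. -/
theorem card_row_col_lt (T : Fin n ≃ μ.cells) (r k : ℕ) :
    (Finset.univ.filter fun i => (T i).1.1 = r ∧ (T i).1.2 < k).card = min k (μ.rowLen r) := by
  rw [← Finset.card_range (min k (μ.rowLen r))]
  refine Finset.card_bij (fun i _ => (T i).1.2) ?_ ?_ ?_
  · intro i hi
    obtain ⟨h1, h2⟩ := (Finset.mem_filter.1 hi).2
    have h3 : (T i).1 ∈ μ := (T i).2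
    rw [Finset.mem_range, lt_min_iff]
    refine ⟨h2, ?_⟩
    rw [← YoungDiagram.mem_iff_lt_rowLen, ← h1]
    exact h3
  · intro i hi j hj hij
    have h1 := (Finset.mem_filter.1 hi).2.1
    have h2 := (Finset.mem_filter.1 hj).2.1
    exact T.injective (Subtype.ext (Prod.ext (h1.trans h2.symm) hij))
  · intro c hc
    rw [Finset.mem_range, lt_min_iff, ← YoungDiagram.mem_iff_lt_rowLen] at hc
    exact ⟨T.symm ⟨(r, c), hc.2⟩, by simp [hc.1], by simp⟩

/-- If the entries of each row of `T` lie in different columns of the tableau `σ T`, then `σ` is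
the product of a row permutation and a column permutation. -/
theorem exists_row_mul_col (T : Fin n ≃ μ.cells) (σ : Equiv.Perm (Fin n))
    (h : ∀ i j, (T i).1.1 = (T j).1.1 → (T (σ⁻¹ i)).1.2 = (T (σ⁻¹ j)).1.2 → i = j) :
    ∃ p ∈ rowStabilizer T, ∃ q ∈ colStabilizer T, σ = p * q := by
  classical
  have hmin (r k : ℕ) : (Finset.univ.filter fun i =>
      (T i).1.1 = r ∧ (T (σ⁻¹ i)).1.2 < k).card ≤ min k (μ.rowLen r) := by
    refine le_min ?_ ?_
    · rw [← Finset.card_range k]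
      refine Finset.card_le_card_of_injOn (fun i => (T (σ⁻¹ i)).1.2) ?_ ?_
      · intro i hi
        simpa using (Finset.mem_filter.1 hi).2.2
      · intro i hi j hj hij
        exact h i j ((Finset.mem_filter.1 hi).2.1.trans (Finset.mem_filter.1 hj).2.1.symm) hij
    · have h1 := card_row_col_lt T r (μ.rowLen r)
      rw [min_self] at h1
      refine le_trans (Finset.card_le_card ?_) h1.le
      intro i hi
      have h2 := (Finset.mem_filter.1 hi).2.1
      have h3 : (T i).1 ∈ μ := (T i).2
      refine Finset.mem_filter.2 ⟨Finset.mem_univ _, h2, ?_⟩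
      rw [← YoungDiagram.mem_iff_lt_rowLen, ← h2]
      exact h3
  have hsum (g : Fin n → ℕ) (k : ℕ) : (Finset.univ.filter fun i => g i < k).card
      = ∑ r ∈ Finset.univ.image fun i => (T i).1.1,
        (Finset.univ.filter fun i => (T i).1.1 = r ∧ g i < k).card := by
    rw [Finset.card_eq_sum_card_fiberwise (f := fun i => (T i).1.1)
      (t := Finset.univ.image fun i => (T i).1.1) (fun i _ => by simp)]
    refine Finset.sum_congr rfl fun r _ => ?_
    rw [Finset.filter_filter]
    simp only [and_comm]
  -- The first k columns of σT and of T hold equally many entries in total, namely ∑ min(k, row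
  -- length), so all the rowwise bounds `hmin` are equalities.
  have heq (k : ℕ) : ∀ r ∈ Finset.univ.image fun i => (T i).1.1, (Finset.univ.filter fun i =>
      (T i).1.1 = r ∧ (T (σ⁻¹ i)).1.2 < k).card = min k (μ.rowLen r) := by
    rw [← Finset.sum_eq_sum_iff_of_le fun r _ => hmin r k, ← hsum]
    simp_rw [← card_row_col_lt T]
    rw [← hsum]
    refine Finset.card_equiv σ⁻¹ fun i => ?_
    simp
  have hmem (i : Fin n) : ((T i).1.1, (T (σ⁻¹ i)).1.2) ∈ μ := by
    rw [YoungDiagram.mem_iff_lt_rowLen]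
    set r := (T i).1.1 with hr
    have h1 := heq (μ.rowLen r) r (by simp [hr])
    -- This threshold exceeds the column of i in σT, so i is counted; nested sets of equal
    -- cardinality coincide, and i already lies below the row length.
    have h2 := heq (μ.rowLen r + (T (σ⁻¹ i)).1.2 + 1) r (by simp [hr])
    rw [min_self] at h1
    rw [min_eq_right (by omega)] at h2
    have h3 : (Finset.univ.filter fun i => (T i).1.1 = r ∧ (T (σ⁻¹ i)).1.2 < μ.rowLen r)
        = Finset.univ.filter fun j =>
          (T j).1.1 = r ∧ (T (σ⁻¹ j)).1.2 < μ.rowLen r + (T (σ⁻¹ i)).1.2 + 1 := by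
      refine Finset.eq_of_subset_of_card_le ?_ (by rw [h1, h2])
      intro j hj
      simp only [Finset.mem_filter, Finset.mem_univ, true_and] at hj ⊢
      exact ⟨hj.1, by omega⟩
    have h4 : i ∈ Finset.univ.filter fun j =>
          (T j).1.1 = r ∧ (T (σ⁻¹ j)).1.2 < μ.rowLen r + (T (σ⁻¹ i)).1.2 + 1 := by
      simp only [Finset.mem_filter, Finset.mem_univ, true_and]
      exact ⟨hr.symm, by omega⟩
    rw [← h3] at h4
    exact (Finset.mem_filter.1 h4).2.2
  -- Within its row of T, the entry i goes to the column that it occupies in σT. Hence p preserves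
  -- rows and pσ preserves columns.
  let g : Fin n → Fin n := fun i => T.symm ⟨((T i).1.1, (T (σ⁻¹ i)).1.2), hmem i⟩
  have hg1 (i : Fin n) : (T (g i)).1.1 = (T i).1.1 := by simp [g]
  have hg2 (i : Fin n) : (T (g i)).1.2 = (T (σ⁻¹ i)).1.2 := by simp [g]
  have hginj : Function.Injective g := fun i j hij =>
    h i j (by rw [← hg1, hij, hg1]) (by rw [← hg2, hij, hg2])
  let p : Equiv.Perm (Fin n) := Equiv.ofBijective g (Finite.injective_iff_bijective.1 hginj)
  have hp (i : Fin n) : p i = g i := rfl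
  have hpR : p ∈ rowStabilizer T := fun i => hg1 i
  refine ⟨p⁻¹, inv_mem hpR, p * σ, fun i => ?_, by group⟩
  rw [Equiv.Perm.mul_apply, hp, hg2]
  simp

end YoungLemma

/-! ### Young symmetrizers, characters and conjugation sums in the group algebra. -/

section YoungAlgebra

open MonoidAlgebra

variable {n : ℕ} {μ : YoungDiagram}

open Classical in
/-- The sum of the row permutations of `T`. -/
def rowSum (T : Fin n ≃ μ.cells) : MonoidAlgebra ℂ (Equiv.Perm (Fin n)) :=
  ∑ p : rowStabilizer T, single (p : Equiv.Perm (Fin n)) 1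

open Classical in
/-- The signed sum of the column permutations of `T`. -/
def colSum (T : Fin n ≃ μ.cells) : MonoidAlgebra ℂ (Equiv.Perm (Fin n)) :=
  ∑ q : colStabilizer T, single (q : Equiv.Perm (Fin n))
    (((Equiv.Perm.sign (q : Equiv.Perm (Fin n)) : ℤˣ) : ℤ) : ℂ)

theorem youngSymmetrizer_eq (T : Fin n ≃ μ.cells) :
    youngSymmetrizer T = rowSum T * colSum T := by
  simp [youngSymmetrizer, rowSum, colSum, Finset.sum_mul_sum, single_mul_single]

theorem rowSum_mul_of (T : Fin n ≃ μ.cells) {p : Equiv.Perm (Fin n)} (hp : p ∈ rowStabilizer T) :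
    rowSum T * of ℂ _ p = rowSum T := by
  classical
  simp only [rowSum, Finset.sum_mul, of_apply, single_mul_single, mul_one]
  exact Fintype.sum_equiv (Equiv.mulRight ⟨p, hp⟩) _ _ fun x => rfl

theorem of_mul_colSum (T : Fin n ≃ μ.cells) {q : Equiv.Perm (Fin n)} (hq : q ∈ colStabilizer T) :
    of ℂ _ q * colSum T = (((Equiv.Perm.sign q : ℤˣ) : ℤ) : ℂ) • colSum T := by
  classical
  simp only [colSum, Finset.mul_sum, of_apply, single_mul_single, one_mul, Finset.smul_sum]
  refine Fintype.sum_equiv (Equiv.mulLeft ⟨q, hq⟩) _ _ fun x => ?_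
  rcases Int.units_eq_one_or (Equiv.Perm.sign q) with h | h <;> simp [h]

theorem colSum_mul_colSum (T : Fin n ≃ μ.cells) :
    colSum T * colSum T = (Nat.card (colStabilizer T) : ℂ) • colSum T := by
  classical
  conv_lhs => enter [1]; rw [colSum]
  rw [Finset.sum_mul, Nat.card_eq_fintype_card, Nat.cast_smul_eq_nsmul, ← Finset.card_univ,
    ← Finset.sum_const]
  refine Finset.sum_congr rfl fun q _ => ?_
  have h := of_mul_colSum T q.2
  have h' : (single (q : Equiv.Perm (Fin n)) (((Equiv.Perm.sign (q : Equiv.Perm (Fin n)) : ℤˣ) : ℤ) : ℂ)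
      : MonoidAlgebra ℂ (Equiv.Perm (Fin n)))
      = (((Equiv.Perm.sign (q : Equiv.Perm (Fin n)) : ℤˣ) : ℤ) : ℂ) • of ℂ _ (q : Equiv.Perm (Fin n)) := by
    simp
  rw [h', smul_mul_assoc, h, smul_smul]
  rcases Int.units_eq_one_or (Equiv.Perm.sign (q : Equiv.Perm (Fin n))) with h | h <;> simp [h]

/-- A permutation is sandwiched between the row sum and the column sum to a real multiple of the
Young symmetrizer. -/
theorem rowSum_of_colSum (T : Fin n ≃ μ.cells) (σ : Equiv.Perm (Fin n)) :
    ∃ t : ℝ, rowSum T * of ℂ _ σ * colSum T = (t : ℂ) • youngSymmetrizer T := by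
  classical
  rw [youngSymmetrizer_eq]
  by_cases h : ∀ i j, (T i).1.1 = (T j).1.1 → (T (σ⁻¹ i)).1.2 = (T (σ⁻¹ j)).1.2 → i = j
  · obtain ⟨p, hp, q, hq, rfl⟩ := exists_row_mul_col T σ h
    refine ⟨((Equiv.Perm.sign q : ℤˣ) : ℤ), ?_⟩
    rw [map_mul, ← mul_assoc, rowSum_mul_of T hp, mul_assoc, of_mul_colSum T hq, mul_smul_comm]
    simp
  · push Not at h
    obtain ⟨i, j, hr, hc, hij⟩ := h
    have hp : Equiv.swap i j ∈ rowStabilizer T := fun k => by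
      rw [Equiv.swap_apply_def]
      split_ifs with h1 h2
      · rw [h1, hr]
      · rw [h2, hr]
      · rfl
    have hq : Equiv.swap (σ⁻¹ i) (σ⁻¹ j) ∈ colStabilizer T := fun k => by
      rw [Equiv.swap_apply_def]
      split_ifs with h1 h2
      · rw [h1, hc]
      · rw [h2, hc]
      · rfl
    have hconj : Equiv.swap i j * σ = σ * Equiv.swap (σ⁻¹ i) (σ⁻¹ j) := by
      rw [Equiv.mul_swap_eq_swap_mul]
      simp
    have hne : σ⁻¹ i ≠ σ⁻¹ j := fun h => hij (σ⁻¹.injective h)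
    -- R absorbs the row transposition without a sign; carried past σ it becomes a column
    -- transposition, which C absorbs with sign −1.
    have h1 : rowSum T * of ℂ _ σ * colSum T = -(rowSum T * of ℂ _ σ * colSum T) := by
      conv_lhs => rw [← rowSum_mul_of T hp]
      rw [mul_assoc (rowSum T), ← map_mul, hconj, map_mul, ← mul_assoc, mul_assoc,
        of_mul_colSum T hq, Equiv.Perm.sign_swap hne]
      simp
    refine ⟨0, ?_⟩
    rw [Complex.ofReal_zero, zero_smul]
    exact (smul_eq_zero_iff_right (two_ne_zero (α := ℂ))).1
      ((two_smul ℂ _).trans (add_eq_zero_iff_eq_neg.2 h1))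

/-- Every element of the group algebra is sandwiched between the row sum and the column sum to a
multiple of the Young symmetrizer. -/
theorem rowSum_mul_colSum (T : Fin n ≃ μ.cells) (x : MonoidAlgebra ℂ (Equiv.Perm (Fin n))) :
    ∃ t : ℂ, rowSum T * x * colSum T = t • youngSymmetrizer T := by
  induction x using MonoidAlgebra.induction_on with
  | of σ =>
    obtain ⟨t, ht⟩ := rowSum_of_colSum T σ
    exact ⟨t, ht⟩
  | add x y hx hy =>
    obtain ⟨t, ht⟩ := hx
    obtain ⟨u, hu⟩ := hy
    exact ⟨t + u, by rw [mul_add, add_mul, ht, hu, add_smul]⟩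
  | smul r x hx =>
    obtain ⟨t, ht⟩ := hx
    exact ⟨r * t, by rw [mul_smul_comm, smul_mul_assoc, ht, smul_smul]⟩

/-- Expand the middle factor of R(CσR)C into signed permutations and apply `rowSum_of_colSum` to
each. That t is real matters later: it makes a sum of squares positive in `schurPairing_injective`.
-/
theorem youngSymmetrizer_of_youngSymmetrizer (T : Fin n ≃ μ.cells) (σ : Equiv.Perm (Fin n)) :
    ∃ t : ℝ, youngSymmetrizer T * of ℂ _ σ * youngSymmetrizer T
      = (t : ℂ) • youngSymmetrizer T := by
  classical
  choose t ht using rowSum_of_colSum T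
  refine ⟨∑ q : colStabilizer T, ∑ p : rowStabilizer T,
    (((Equiv.Perm.sign (q : Equiv.Perm (Fin n)) : ℤˣ) : ℤ) : ℝ) * t (q * σ * p), ?_⟩
  have h1 : colSum T * of ℂ _ σ * rowSum T = ∑ q : colStabilizer T, ∑ p : rowStabilizer T,
      (((Equiv.Perm.sign (q : Equiv.Perm (Fin n)) : ℤˣ) : ℤ) : ℂ) • of ℂ _ (q * σ * p) := by
    simp [rowSum, colSum, Finset.sum_mul, Finset.mul_sum, single_mul_single]
    exact Finset.sum_comm
  have h2 : youngSymmetrizer T * of ℂ _ σ * youngSymmetrizer T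
      = rowSum T * (colSum T * of ℂ _ σ * rowSum T) * colSum T := by
    simp only [youngSymmetrizer_eq, mul_assoc]
  rw [h2, h1]
  simp only [Finset.mul_sum, Finset.sum_mul, mul_smul_comm, smul_mul_assoc, ht, smul_smul]
  push_cast
  simp only [Finset.sum_smul]

/-- If pq = 1, then p preserves all rows and all columns, hence is the identity; a single term
contributes. -/
theorem youngSymmetrizer_coeff_one (T : Fin n ≃ μ.cells) : (youngSymmetrizer T).coeff 1 = 1 := by
  classical
  simp only [youngSymmetrizer, coeff_sum, Finsupp.finsetSum_apply, coeff_single]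
  rw [Finset.sum_eq_single 1, Finset.sum_eq_single 1]
  · simp
  · intro q _ hq
    refine Finsupp.single_eq_of_ne ?_
    simpa [eq_comm] using hq
  · simp
  · intro p _ hp
    refine Finset.sum_eq_zero fun q _ => Finsupp.single_eq_of_ne fun h => hp ?_
    have hpq : (p : Equiv.Perm (Fin n)) = (q : Equiv.Perm (Fin n))⁻¹ := eq_inv_of_mul_eq_one_left h.symm
    have hpc : (p : Equiv.Perm (Fin n)) ∈ colStabilizer T := hpq ▸ inv_mem q.2
    refine Subtype.ext (Equiv.ext fun i => T.injective (Subtype.ext (Prod.ext ?_ ?_)))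
    · exact p.2 i
    · exact hpc i
  · simp

/-- The linear map of the group algebra that inverts the permutations. -/
def inversion (n : ℕ) : MonoidAlgebra ℂ (Equiv.Perm (Fin n)) →ₗ[ℂ]
    MonoidAlgebra ℂ (Equiv.Perm (Fin n)) :=
  (MonoidAlgebra.basis (Equiv.Perm (Fin n)) ℂ).constr ℂ fun σ => of ℂ _ σ⁻¹

theorem inversion_of (σ : Equiv.Perm (Fin n)) : inversion n (of ℂ _ σ) = of ℂ _ σ⁻¹ := by
  have h : of ℂ _ σ = MonoidAlgebra.basis (Equiv.Perm (Fin n)) ℂ σ := by simp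
  rw [h, inversion, Module.Basis.constr_basis]

theorem inversion_single (σ : Equiv.Perm (Fin n)) (t : ℂ) :
    inversion n (single σ t) = single σ⁻¹ t := by
  have h := congrArg (t • ·) (inversion_of σ)
  simpa [← map_smul] using h

theorem inversion_coeff (x : MonoidAlgebra ℂ (Equiv.Perm (Fin n))) (σ : Equiv.Perm (Fin n)) :
    (inversion n x).coeff σ = x.coeff σ⁻¹ := by
  classical
  induction x using MonoidAlgebra.induction_on with
  | of τ =>
    rw [inversion_of]
    simp [Finsupp.single_apply, inv_eq_iff_eq_inv]
  | add x y hx hy => simp [hx, hy]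
  | smul r x hx => simp [hx]

theorem inversion_youngSymmetrizer (T : Fin n ≃ μ.cells) :
    inversion n (youngSymmetrizer T) = colSum T * rowSum T := by
  classical
  simp only [youngSymmetrizer, rowSum, colSum, map_sum, Finset.sum_mul_sum, single_mul_single,
    inversion_single, mul_one, mul_inv_rev]
  rw [Finset.sum_comm]
  refine Fintype.sum_equiv (Equiv.inv _) _ _ fun q => ?_
  refine Fintype.sum_equiv (Equiv.inv _) _ _ fun p => ?_
  simp

/-- The sum of the conjugates of an element of the group algebra. -/
def conjSum (n : ℕ) : MonoidAlgebra ℂ (Equiv.Perm (Fin n)) →ₗ[ℂ]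
    MonoidAlgebra ℂ (Equiv.Perm (Fin n)) :=
  ∑ τ : Equiv.Perm (Fin n), LinearMap.mulLeft ℂ (of ℂ _ τ) ∘ₗ LinearMap.mulRight ℂ (of ℂ _ τ⁻¹)

theorem conjSum_apply (x : MonoidAlgebra ℂ (Equiv.Perm (Fin n))) :
    conjSum n x = ∑ τ : Equiv.Perm (Fin n), of ℂ _ τ * x * of ℂ _ τ⁻¹ := by
  simp [conjSum, LinearMap.sum_apply, mul_assoc]

/-- For a permutation σ, σy is the conjugate of yσ by σ, and summing over all conjugates removes the
difference. -/
theorem conjSum_mul_comm (x y : MonoidAlgebra ℂ (Equiv.Perm (Fin n))) :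
    conjSum n (x * y) = conjSum n (y * x) := by
  induction x using MonoidAlgebra.induction_on with
  | of σ =>
    rw [conjSum_apply, conjSum_apply]
    refine Fintype.sum_equiv (Equiv.mulRight σ) _ _ fun τ => ?_
    simp only [Equiv.coe_mulRight, map_mul, mul_inv_rev, mul_assoc]
    rw [← mul_assoc (of ℂ _ σ) (of ℂ _ σ⁻¹), ← map_mul]
    simp
  | add x z hx hz => rw [add_mul, mul_add, map_add, map_add, hx, hz]
  | smul r x hx => rw [smul_mul_assoc, mul_smul_comm, map_smul, map_smul, hx]

theorem conjSum_coeff (x : MonoidAlgebra ℂ (Equiv.Perm (Fin n))) (σ : Equiv.Perm (Fin n)) :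
    (conjSum n x).coeff σ = ∑ τ : Equiv.Perm (Fin n), x.coeff (τ⁻¹ * σ * τ) := by
  simp [conjSum_apply, coeff_sum, of_apply, mul_assoc]

/-- The trace of `x ↦ σ x a` on the group algebra. -/
theorem trace_mulLeft_mulRight (σ : Equiv.Perm (Fin n))
    (a : MonoidAlgebra ℂ (Equiv.Perm (Fin n))) :
    LinearMap.trace ℂ _ (LinearMap.mulLeft ℂ (of ℂ _ σ) ∘ₗ LinearMap.mulRight ℂ a)
      = (conjSum n (inversion n a)).coeff σ := by
  rw [LinearMap.trace_eq_matrix_trace ℂ (MonoidAlgebra.basis (Equiv.Perm (Fin n)) ℂ),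
    conjSum_coeff, Matrix.trace]
  refine Finset.sum_congr rfl fun τ _ => ?_
  rw [Matrix.diag_apply, LinearMap.toMatrix_apply, inversion_coeff]
  simp [MonoidAlgebra.basis, mul_assoc]

/-- The character of the Specht module is, up to a factor, the conjugation average of the Young
symmetrizer; the factor is the eigenvalue of the Young symmetrizer. -/
theorem mul_spechtCharacter (T : Fin n ≃ μ.cells) {t : ℂ}
    (ht : youngSymmetrizer T * youngSymmetrizer T = t • youngSymmetrizer T)
    (σ : Equiv.Perm (Fin n)) :
    t * spechtCharacter T σ = (conjSum n (inversion n (youngSymmetrizer T))).coeff σ := by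
  -- The map x ↦ σxc lands in the left ideal generated by c, so its trace is that of its restriction
  -- there, where right multiplication by c is the scalar t.
  have hmem (x : MonoidAlgebra ℂ (Equiv.Perm (Fin n))) :
      (LinearMap.mulLeft ℂ (of ℂ _ σ) ∘ₗ LinearMap.mulRight ℂ (youngSymmetrizer T)) x
        ∈ (specht T).toSubmodule := ⟨of ℂ _ σ * x, by simp [mul_assoc]⟩
  rw [← trace_mulLeft_mulRight, ← LinearMap.trace_restrict_eq_of_forall_mem _ _ hmem,
    spechtCharacter, Representation.character, ← smul_eq_mul, ← map_smul]
  congr 1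
  ext ⟨_, x, rfl⟩ : 2
  simp [Subrepresentation.toRepresentation, regularRep, mul_assoc, ht]

/-- If c² were 0, the trace formula `mul_spechtCharacter` at σ = 1 would read 0 = n!, as c has
coefficient 1 at the identity. -/
theorem exists_youngSymmetrizer_sq (T : Fin n ≃ μ.cells) :
    ∃ t : ℝ, t ≠ 0 ∧
      youngSymmetrizer T * youngSymmetrizer T = (t : ℂ) • youngSymmetrizer T := by
  obtain ⟨t, ht⟩ := youngSymmetrizer_of_youngSymmetrizer T 1
  rw [map_one, mul_one] at ht
  refine ⟨t, ?_, ht⟩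
  rintro rfl
  have h := mul_spechtCharacter T ht 1
  simp [conjSum_coeff, inversion_coeff, youngSymmetrizer_coeff_one] at h
  exact Fintype.card_ne_zero (by exact_mod_cast h.symm)

/-- The character of the Specht module as an element of the group algebra. -/
def characterSum (T : Fin n ≃ μ.cells) : MonoidAlgebra ℂ (Equiv.Perm (Fin n)) :=
  ∑ σ : Equiv.Perm (Fin n), single σ (spechtCharacter T σ)

/-- The trace formula involves c* = CR, whose conjugation sum equals that of RC = c. -/
theorem smul_characterSum (T : Fin n ≃ μ.cells) {t : ℂ}
    (ht : youngSymmetrizer T * youngSymmetrizer T = t • youngSymmetrizer T) :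
    t • characterSum T = conjSum n (youngSymmetrizer T) := by
  classical
  have h : conjSum n (youngSymmetrizer T) = conjSum n (inversion n (youngSymmetrizer T)) := by
    rw [inversion_youngSymmetrizer, youngSymmetrizer_eq, conjSum_mul_comm]
  rw [h]
  ext σ
  rw [← mul_spechtCharacter T ht]
  simp [characterSum, coeff_sum, Finsupp.single_apply]

theorem spechtCharacter_one (T : Fin n ≃ μ.cells) :
    spechtCharacter T 1 = (Module.finrank ℂ (specht T).toSubmodule : ℂ) :=
  Representation.char_one _

theorem finrank_specht_ne_zero (T : Fin n ≃ μ.cells) :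
    (Module.finrank ℂ (specht T).toSubmodule : ℂ) ≠ 0 := by
  obtain ⟨t, -, ht⟩ := exists_youngSymmetrizer_sq T
  intro h0
  have h := mul_spechtCharacter T ht 1
  rw [spechtCharacter_one, h0] at h
  simp [conjSum_coeff, inversion_coeff, youngSymmetrizer_coeff_one] at h
  exact Fintype.card_ne_zero (by exact_mod_cast h.symm)

theorem youngSymmetrizer_mul_inversion (T : Fin n ≃ μ.cells) :
    youngSymmetrizer T * inversion n (youngSymmetrizer T)
      = (Nat.card (colStabilizer T) : ℂ) • (youngSymmetrizer T * rowSum T) := by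
  rw [inversion_youngSymmetrizer, youngSymmetrizer_eq, mul_assoc, ← mul_assoc (colSum T),
    colSum_mul_colSum, smul_mul_assoc, mul_smul_comm, mul_assoc]

/-- Here cc* = RCCR is cR times the order of the column group, and a cyclic rotation under `conjSum`
brings the last R to the front. The result has the form R⋯C required by von Neumann's lemma. -/
theorem conjSum_mul_youngSymmetrizer_mul_inversion (T : Fin n ≃ μ.cells)
    (x : MonoidAlgebra ℂ (Equiv.Perm (Fin n))) :
    conjSum n (x * youngSymmetrizer T * inversion n (youngSymmetrizer T))
      = (Nat.card (colStabilizer T) : ℂ) • conjSum n (rowSum T * (x * rowSum T) * colSum T) := by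
  rw [mul_assoc, youngSymmetrizer_mul_inversion, mul_smul_comm, map_smul, ← mul_assoc,
    conjSum_mul_comm, youngSymmetrizer_eq]
  simp only [mul_assoc]

/-- The elements `x c c*` have conjugation averages proportional to that of the Young
symmetrizer `c`. -/
theorem exists_conjSum_eq_smul (T : Fin n ≃ μ.cells)
    (x : MonoidAlgebra ℂ (Equiv.Perm (Fin n))) :
    ∃ t : ℂ, conjSum n (x * youngSymmetrizer T * inversion n (youngSymmetrizer T))
      = t • conjSum n (youngSymmetrizer T) := by
  obtain ⟨t, ht⟩ := rowSum_mul_colSum T (x * rowSum T)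
  exact ⟨_, by rw [conjSum_mul_youngSymmetrizer_mul_inversion, ht, map_smul, smul_smul]⟩

/-- For x = C the factor in `exists_conjSum_eq_smul` is nonzero, because RCRC = c² is a nonzero
multiple of c. This puts the immanant into the weight-zero image. -/
theorem exists_conjSum_youngSymmetrizer_eq_smul (T : Fin n ≃ μ.cells) :
    ∃ t : ℂ, conjSum n (youngSymmetrizer T)
      = t • conjSum n (colSum T * youngSymmetrizer T * inversion n (youngSymmetrizer T)) := by
  obtain ⟨t, ht0, ht⟩ := exists_youngSymmetrizer_sq T
  refine ⟨((Nat.card (colStabilizer T) : ℂ) * t)⁻¹, ?_⟩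
  have h : rowSum T * (colSum T * rowSum T) * colSum T
      = youngSymmetrizer T * youngSymmetrizer T := by
    simp only [youngSymmetrizer_eq, mul_assoc]
  have h0 : (Nat.card (colStabilizer T) : ℂ) ≠ 0 := Nat.cast_ne_zero.2 Nat.card_pos.ne'
  rw [conjSum_mul_youngSymmetrizer_mul_inversion, h, ht, map_smul, smul_smul, smul_smul, mul_assoc,
    inv_mul_cancel₀ (mul_ne_zero h0 (Complex.ofReal_ne_zero.2 ht0)), one_smul]

/-- The space `c A c*` is spanned by `c c*`. -/
theorem youngSymmetrizer_mul_mul_inversion (T : Fin n ≃ μ.cells)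
    (x : MonoidAlgebra ℂ (Equiv.Perm (Fin n))) :
    ∃ t : ℂ, youngSymmetrizer T * x * inversion n (youngSymmetrizer T)
      = t • (youngSymmetrizer T * inversion n (youngSymmetrizer T)) := by
  -- cxc* = (R(Cx)C)R is a multiple of cR, hence of cc*.
  obtain ⟨t, ht⟩ := rowSum_mul_colSum T (colSum T * x)
  have h0 : (Nat.card (colStabilizer T) : ℂ) ≠ 0 := Nat.cast_ne_zero.2 Nat.card_pos.ne'
  refine ⟨t * (Nat.card (colStabilizer T) : ℂ)⁻¹, ?_⟩
  rw [youngSymmetrizer_mul_inversion, smul_smul, mul_assoc t, inv_mul_cancel₀ h0, mul_one,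
    ← smul_mul_assoc, ← ht, inversion_youngSymmetrizer, youngSymmetrizer_eq]
  simp only [mul_assoc]

end YoungAlgebra

/-! ### The right action of the group algebra on tensor powers. -/

section PlaceAction

open MonoidAlgebra

variable {n : ℕ} {E : Type*} [AddCommGroup E] [Module ℂ E]

theorem placeAction_add (a b : MonoidAlgebra ℂ (Equiv.Perm (Fin n))) (x : ⨂[ℂ] _ : Fin n, E) :
    placeAction E (a + b) x = placeAction E a x + placeAction E b x := by
  simp [placeAction, LinearMap.sum_apply, add_smul, Finset.sum_add_distrib]

theorem placeAction_smul (t : ℂ) (a : MonoidAlgebra ℂ (Equiv.Perm (Fin n)))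
    (x : ⨂[ℂ] _ : Fin n, E) : placeAction E (t • a) x = t • placeAction E a x := by
  simp [placeAction, LinearMap.sum_apply, mul_smul, Finset.smul_sum]

theorem placeAction_of (σ : Equiv.Perm (Fin n)) (x : ⨂[ℂ] _ : Fin n, E) :
    placeAction E (of ℂ _ σ) x = placePerm E σ x := by
  classical
  simp [placeAction, Finsupp.single_apply]

theorem placePerm_one (x : ⨂[ℂ] _ : Fin n, E) : placePerm E 1 x = x := by
  have h : placePerm (n := n) E 1 = LinearMap.id := by
    ext v
    simp [placePerm_tprod]
  rw [h, LinearMap.id_apply]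

theorem placePerm_mul (σ τ : Equiv.Perm (Fin n)) (x : ⨂[ℂ] _ : Fin n, E) :
    placePerm E (σ * τ) x = placePerm E τ (placePerm E σ x) := by
  have h : placePerm E (σ * τ) = placePerm E τ ∘ₗ placePerm E σ := by
    ext v
    simp [placePerm_tprod]
  rw [h, LinearMap.comp_apply]

theorem placeAction_mul (a b : MonoidAlgebra ℂ (Equiv.Perm (Fin n))) (x : ⨂[ℂ] _ : Fin n, E) :
    placeAction E (a * b) x = placeAction E b (placeAction E a x) := by
  induction a using MonoidAlgebra.induction_on with
  | of σ =>
    induction b using MonoidAlgebra.induction_on with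
    | of τ => rw [← map_mul, placeAction_of, placeAction_of, placeAction_of, placePerm_mul]
    | add b b' hb hb' => rw [mul_add, placeAction_add, placeAction_add, hb, hb']
    | smul t b hb => rw [mul_smul_comm, placeAction_smul, placeAction_smul, hb]
  | add a a' ha ha' => rw [add_mul, placeAction_add, placeAction_add, map_add, ha, ha']
  | smul t a ha => rw [smul_mul_assoc, placeAction_smul, placeAction_smul, map_smul, ha]

theorem tensorPowerRep_tprod (g : LinearMap.GeneralLinearGroup ℂ E) (v : Fin n → E) :
    tensorPowerRep E n g (PiTensorProduct.tprod ℂ v)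
      = PiTensorProduct.tprod ℂ fun i => naturalRep E g (v i) :=
  PiTensorProduct.map_tprod _ _

theorem tensorPowerRep_placeAction (g : LinearMap.GeneralLinearGroup ℂ E)
    (a : MonoidAlgebra ℂ (Equiv.Perm (Fin n))) (x : ⨂[ℂ] _ : Fin n, E) :
    tensorPowerRep E n g (placeAction E a x) = placeAction E a (tensorPowerRep E n g x) := by
  simp [placeAction, LinearMap.sum_apply, tensorPowerRep_placePerm]

end PlaceAction

/-! ### Multilinear maps are determined by their values on bases. -/

section Density

/-- A multilinear map in `n` vectors of an `n`-dimensional space that vanishes on all bases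
is zero. -/
theorem multilinearMap_eq_zero {n : ℕ} {E N : Type*} [AddCommGroup E] [Module ℂ E]
    [AddCommGroup N] [Module ℂ N] (e : Module.Basis (Fin n) ℂ E)
    (f : MultilinearMap ℂ (fun _ : Fin n => E) N)
    (hf : ∀ g : LinearMap.GeneralLinearGroup ℂ E, f (fun i => naturalRep E g (e i)) = 0) :
    f = 0 := by
  classical
  ext v
  rw [zero_apply, ← Module.forall_dual_apply_eq_zero_iff ℂ]
  intro ξ
  have : FiniteDimensional ℂ E := Module.Finite.of_basis e
  let A : Module.End ℂ E := e.constr ℂ v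
  -- The multilinear expansion of t ↦ ξ(f(v + te)), where s records the places that take the entry
  -- of v.
  let p : Polynomial ℂ := ∑ s : Finset (Fin n),
    Polynomial.monomial (Finset.card sᶜ) (ξ (f (s.piecewise v e)))
  have hp (t : ℂ) : p.eval t = ξ (f (v + t • ⇑e)) := by
    rw [MultilinearMap.map_add_univ, map_sum, Polynomial.eval_finsetSum]
    refine Finset.sum_congr rfl fun s _ => ?_
    rw [Polynomial.eval_monomial]
    have h := f.map_piecewise_smul (fun _ => t) (s.piecewise v e) sᶜ
    have h2 : sᶜ.piecewise (fun i => t • s.piecewise v (⇑e) i) (s.piecewise v ⇑e)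
        = s.piecewise v (t • ⇑e) := by
      ext i
      by_cases hi : i ∈ s <;> simp [hi]
    rw [h2] at h
    rw [h, map_smul, Finset.prod_const, smul_eq_mul, mul_comm]
  have hroot : {t : ℂ | p.IsRoot t}.Infinite := by
    -- v + te is the image of the basis e under A + t, which is invertible unless t lies in the
    -- finite spectrum of −A.
    refine Set.Infinite.mono ?_ (Module.End.finite_spectrum (-A)).infinite_compl
    intro t ht
    have hu : IsUnit (algebraMap ℂ (Module.End ℂ E) t - -A) := by
      by_contra h
      exact ht h
    obtain ⟨g, hg⟩ := hu
    rw [Set.mem_ofPred_eq, Polynomial.IsRoot.def, hp]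
    have h1 : (v + t • ⇑e) = fun i => naturalRep E g (e i) := by
      ext i
      have : naturalRep E g (e i) = (g : Module.End ℂ E) (e i) := rfl
      rw [this, hg]
      simp [A, add_comm, Module.algebraMap_end_apply]
    rw [h1, hf, map_zero]
  have h0 := hp 0
  rw [Polynomial.eq_zero_of_infinite_isRoot p hroot] at h0
  simpa using h0.symm

/-- Multilinear maps in `n` vectors of an `n`-dimensional space that agree on all bases are
equal. -/
theorem multilinearMap_ext_bases {n : ℕ} {E N : Type*} [AddCommGroup E] [Module ℂ E]
    [AddCommGroup N] [Module ℂ N] (e : Module.Basis (Fin n) ℂ E)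
    {f f' : MultilinearMap ℂ (fun _ : Fin n => E) N}
    (h : ∀ g : LinearMap.GeneralLinearGroup ℂ E,
      f (fun i => naturalRep E g (e i)) = f' (fun i => naturalRep E g (e i))) : f = f' :=
  sub_eq_zero.1 (multilinearMap_eq_zero e (f - f') fun g => sub_eq_zero.2 (h g))

end Density

/-! ### Weight-zero vectors in a span of torus eigenvectors. -/

section Weights

/-- A polynomial in D that vanishes at the eigenvalues other than 1, but not at 1, kills the
unwanted eigenvectors and only rescales x. Linear independence of the M i is not needed. -/
theorem mem_span_eigenvectors {V I : Type*} [AddCommGroup V] [Module ℂ V] [Fintype I]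
    (D : Module.End ℂ V) (M : I → V) (d : I → ℂ) (hM : ∀ i, D (M i) = d i • M i) (S : Set I)
    {x : V} (hx : x ∈ Submodule.span ℂ (M '' S)) (hD : D x = x) :
    x ∈ Submodule.span ℂ (M '' {i ∈ S | d i = 1}) := by
  classical
  have haeval (q : Polynomial ℂ) (y : V) (t : ℂ) (hy : D y = t • y) :
      Polynomial.aeval D q y = q.eval t • y := by
    by_cases h0 : y = 0
    · simp [h0]
    · exact Module.End.aeval_apply_of_hasEigenvector ⟨Module.End.mem_eigenspace_iff.2 hy, h0⟩
  let q : Polynomial ℂ :=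
    ∏ t ∈ (Finset.univ.image d).erase 1, (Polynomial.X - Polynomial.C t)
  have hq1 : q.eval 1 ≠ 0 := by
    rw [Polynomial.eval_prod, Finset.prod_ne_zero_iff]
    intro t ht
    simpa [sub_eq_zero] using (Finset.ne_of_mem_erase ht).symm
  have hq (i : I) (hi : d i ≠ 1) : q.eval (d i) = 0 := by
    rw [Polynomial.eval_prod]
    exact Finset.prod_eq_zero (i := d i)
      (Finset.mem_erase.2 ⟨hi, Finset.mem_image_of_mem _ (Finset.mem_univ _)⟩) (by simp)
  have hmem : Polynomial.aeval D q x ∈ Submodule.span ℂ (M '' {i ∈ S | d i = 1}) := by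
    have h1 := Submodule.mem_map_of_mem (f := Polynomial.aeval D q) hx
    rw [Submodule.map_span] at h1
    refine Submodule.span_le.2 ?_ h1
    rintro _ ⟨_, ⟨i, hi, rfl⟩, rfl⟩
    rw [SetLike.mem_coe, haeval q (M i) (d i) (hM i)]
    by_cases h : d i = 1
    · exact Submodule.smul_mem _ _ (Submodule.subset_span ⟨i, ⟨hi, h⟩, rfl⟩)
    · rw [hq i h, zero_smul]
      exact zero_mem _
  rw [haeval q x 1 (by rw [hD, one_smul])] at hmem
  exact (Submodule.smul_mem_iff _ hq1).1 hmem

theorem exists_torus_weight_ne_one {n : ℕ} (k : Fin n → Fin n) (hk : ¬ Function.Bijective k) :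
    ∃ a : Fin n → ℂˣ, ∏ i, a i = 1 ∧ ∏ i, (a (k i) : ℂ) ≠ 1 := by
  classical
  rw [← Finite.surjective_iff_bijective] at hk
  simp only [Function.Surjective, not_forall, not_exists] at hk
  obtain ⟨j, hj⟩ := hk
  let u : ℂˣ := Units.mk0 2 two_ne_zero
  -- Scaling by 2 at k j and by 1/2 at the missed index j has determinant 1; the weight is 2 to the
  -- number of i with k i = k j, which is positive since i = j counts.
  refine ⟨fun i => (Pi.mulSingle (k j) u : Fin n → ℂˣ) i * (Pi.mulSingle j u⁻¹ : Fin n → ℂˣ) i,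
    ?_, ?_⟩
  · rw [Finset.prod_mul_distrib, Finset.prod_pi_mulSingle', Finset.prod_pi_mulSingle']
    simp
  · have h (i : Fin n) : (((Pi.mulSingle (k j) u : Fin n → ℂˣ) (k i) *
        (Pi.mulSingle j u⁻¹ : Fin n → ℂˣ) (k i) : ℂˣ) : ℂ)
        = if k i = k j then 2 else 1 := by
      rw [Pi.mulSingle_eq_of_ne (hj i), mul_one, Pi.mulSingle_apply]
      split_ifs <;> simp [u]
    simp only [h]
    rw [Finset.prod_ite]
    simp only [Finset.prod_const, one_pow, mul_one]
    intro h2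
    have h3 : (2 : ℕ) ^ (Finset.univ.filter fun i => k i = k j).card = 1 := by exact_mod_cast h2
    have h4 : (Finset.univ.filter fun i => k i = k j).card = 0 := by simpa using h3
    exact Finset.notMem_empty j (Finset.card_eq_zero.1 h4 ▸ by simp)

/-- A weight-zero vector in the span of torus eigenvectors of weights `∏ a (k i)` lies in the span
of those for which `k` is a permutation. -/
theorem mem_span_of_mem_weightZero {n : ℕ} {E : Type*} [AddCommGroup E] [Module ℂ E]
    (e : Module.Basis (Fin n) ℂ E) {V I : Type*} [AddCommGroup V] [Module ℂ V] [Finite I]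
    (ρ : Representation ℂ (LinearMap.GeneralLinearGroup ℂ E) V) (M : I → V)
    (k : I → Fin n → Fin n)
    (hM : ∀ a i, ρ (diagonal e a) (M i) = (∏ l, (a (k i l) : ℂ)) • M i) (S : Set I) {x : V}
    (hx : x ∈ Submodule.span ℂ (M '' S)) (h0 : x ∈ weightZero e ρ) :
    x ∈ Submodule.span ℂ (M '' {i ∈ S | Function.Bijective (k i)}) := by
  classical
  have := Fintype.ofFinite I
  -- The bad indices are discarded one by one, each by a torus element chosen for it.
  have h (B : Finset I) : (∀ i ∈ B, ¬ Function.Bijective (k i)) →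
      x ∈ Submodule.span ℂ (M '' {i ∈ S | i ∉ B}) := by
    induction B using Finset.induction_on with
    | empty => intro; simpa using hx
    | insert i B hi ih =>
      intro hB
      have h1 := ih fun j hj => hB j (Finset.mem_insert_of_mem hj)
      obtain ⟨a, ha, hne⟩ := exists_torus_weight_ne_one (k i) (hB i (Finset.mem_insert_self _ _))
      have h2 := mem_span_eigenvectors (ρ (diagonal e a)) M _ (hM a) _ h1 (h0 a ha)
      refine Submodule.span_mono (Set.image_mono ?_) h2
      rintro j ⟨⟨hj1, hj2⟩, hj3⟩
      refine ⟨hj1, fun hj => ?_⟩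
      rcases Finset.mem_insert.1 hj with rfl | hj
      · exact hne hj3
      · exact hj2 hj
  have h2 := h (Finset.univ.filter fun i => ¬ Function.Bijective (k i)) (by simp)
  simpa using h2

end Weights

/-! ### The pairing of tensor powers into the symmetric power, and polarization. -/

section Pairing

open MonoidAlgebra

variable {n : ℕ} {E F : Type*} [AddCommGroup E] [Module ℂ E] [AddCommGroup F] [Module ℂ F]

/-- The bilinear map `(v₁ ⊗ ⋯ ⊗ vₙ, w₁ ⊗ ⋯ ⊗ wₙ) ↦ ∏ vᵢ ⊗ wᵢ` into `S^n(E ⊗ F)`. -/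
def symPairing (n : ℕ) (E F : Type*) [AddCommGroup E] [Module ℂ E] [AddCommGroup F] [Module ℂ F] :
    (⨂[ℂ] _ : Fin n, E) →ₗ[ℂ] (⨂[ℂ] _ : Fin n, F) →ₗ[ℂ] Sym[ℂ]^n (E ⊗[ℂ] F) :=
  (PiTensorProduct.map₂ fun _ => TensorProduct.mk ℂ E F).compr₂ (SymmetricPower.mk ℂ (Fin n) _)

theorem symPairing_tprod (v : Fin n → E) (w : Fin n → F) :
    symPairing n E F (PiTensorProduct.tprod ℂ v) (PiTensorProduct.tprod ℂ w)
      = SymmetricPower.tprod ℂ fun i => v i ⊗ₜ[ℂ] w i := by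
  rw [symPairing, LinearMap.compr₂_apply, PiTensorProduct.map₂_tprod_tprod]
  rfl

/-- Bilinear maps on tensor powers are determined by their values on pure tensors. -/
theorem tensorPower_ext₂ {N : Type*} [AddCommGroup N] [Module ℂ N]
    {B B' : (⨂[ℂ] _ : Fin n, E) →ₗ[ℂ] (⨂[ℂ] _ : Fin n, F) →ₗ[ℂ] N}
    (h : ∀ v w, B (PiTensorProduct.tprod ℂ v) (PiTensorProduct.tprod ℂ w)
      = B' (PiTensorProduct.tprod ℂ v) (PiTensorProduct.tprod ℂ w)) : B = B' := by
  ext v w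
  simpa using h v w

theorem symPairing_placePerm (σ : Equiv.Perm (Fin n)) (x : ⨂[ℂ] _ : Fin n, E)
    (y : ⨂[ℂ] _ : Fin n, F) :
    symPairing n E F (placePerm E σ x) (placePerm F σ y) = symPairing n E F x y := by
  have h : (symPairing n E F).compl₁₂ (placePerm E σ) (placePerm F σ) = symPairing n E F := by
    refine tensorPower_ext₂ fun v w => ?_
    rw [LinearMap.compl₁₂_apply, placePerm_tprod, placePerm_tprod, symPairing_tprod,
      symPairing_tprod]
    exact SymmetricPower.tprod_equiv σ fun i => v i ⊗ₜ[ℂ] w i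
  exact LinearMap.congr_fun₂ h x y

/-- Permuting both arguments together only reorders commuting factors, so a permutation of one
argument amounts to its inverse on the other. -/
theorem symPairing_placeAction (a : MonoidAlgebra ℂ (Equiv.Perm (Fin n)))
    (x : ⨂[ℂ] _ : Fin n, E) (y : ⨂[ℂ] _ : Fin n, F) :
    symPairing n E F (placeAction E a x) y
      = symPairing n E F x (placeAction F (inversion n a) y) := by
  induction a using MonoidAlgebra.induction_on with
  | of σ =>
    rw [inversion_of, placeAction_of, placeAction_of, ← symPairing_placePerm σ x,
      ← placePerm_mul, inv_mul_cancel, placePerm_one]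
  | add a b ha hb =>
    rw [placeAction_add, map_add, map_add, LinearMap.add_apply, placeAction_add, map_add, ha, hb]
  | smul t a ha =>
    rw [placeAction_smul, map_smul, map_smul, LinearMap.smul_apply, placeAction_smul, map_smul, ha]

theorem symTensorRep_symPairing
    (g : LinearMap.GeneralLinearGroup ℂ E × LinearMap.GeneralLinearGroup ℂ F)
    (x : ⨂[ℂ] _ : Fin n, E) (y : ⨂[ℂ] _ : Fin n, F) :
    symTensorRep n E F g (symPairing n E F x y)
      = symPairing n E F (tensorPowerRep E n g.1 x) (tensorPowerRep F n g.2 y) := by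
  have h : (symPairing n E F).compr₂ (symTensorRep n E F g)
      = (symPairing n E F).compl₁₂ (tensorPowerRep E n g.1) (tensorPowerRep F n g.2) := by
    refine tensorPower_ext₂ fun v w => ?_
    rw [LinearMap.compl₁₂_apply, LinearMap.compr₂_apply, tensorPowerRep_tprod,
      tensorPowerRep_tprod, symPairing_tprod, symPairing_tprod]
    exact symMap_tprod _ _
  exact LinearMap.congr_fun₂ h x y

/-- The products of basis vectors span the symmetric power. -/
theorem span_symPairing_basis (e : Module.Basis (Fin n) ℂ E) (f : Module.Basis (Fin n) ℂ F) :
    Submodule.span ℂ (Set.range fun k : (Fin n → Fin n) × (Fin n → Fin n) =>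
      symPairing n E F (PiTensorProduct.tprod ℂ fun i => e (k.1 i))
        (PiTensorProduct.tprod ℂ fun i => f (k.2 i))) = ⊤ := by
  set S := Submodule.span ℂ (Set.range fun k : (Fin n → Fin n) × (Fin n → Fin n) =>
      symPairing n E F (PiTensorProduct.tprod ℂ fun i => e (k.1 i))
        (PiTensorProduct.tprod ℂ fun i => f (k.2 i)))
  rw [← S.ker_mkQ, LinearMap.ker_eq_top]
  have h : S.mkQ.compMultilinearMap (SymmetricPower.tprod ℂ (ι := Fin n) (M := E ⊗[ℂ] F)) = 0 := by
    refine Module.Basis.ext_multilinear (fun _ => e.tensorProduct f) fun k => ?_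
    simp only [Module.Basis.tensorProduct_apply', LinearMap.compMultilinearMap_apply,
      zero_apply, Submodule.mkQ_apply, Submodule.Quotient.mk_eq_zero]
    refine Submodule.subset_span ⟨(fun i => (k i).1, fun i => (k i).2), ?_⟩
    exact symPairing_tprod _ _
  exact sym_ext fun v => DFunLike.congr_fun h v

/-- The linear map `(v₁ ⊗ w₁) ⊗ ⋯ ⊗ (vₙ ⊗ wₙ) ↦ (v₁ ⊗ ⋯ ⊗ vₙ) ⊗ (w₁ ⊗ ⋯ ⊗ wₙ)`, given by its
values on basis vectors. -/
def splitTensor (e : Module.Basis (Fin n) ℂ E) (f : Module.Basis (Fin n) ℂ F) :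
    (⨂[ℂ] _ : Fin n, E ⊗[ℂ] F) →ₗ[ℂ] (⨂[ℂ] _ : Fin n, E) ⊗[ℂ] (⨂[ℂ] _ : Fin n, F) :=
  (Basis.piTensorProduct fun _ : Fin n => e.tensorProduct f).constr ℂ fun k =>
    (PiTensorProduct.tprod ℂ fun i => e (k i).1) ⊗ₜ (PiTensorProduct.tprod ℂ fun i => f (k i).2)

/-- Polarization of symmetric tensors, `∏ vᵢ ⊗ wᵢ ↦ ∑ v σ ⊗ w σ`. -/
def polarization (e : Module.Basis (Fin n) ℂ E) (f : Module.Basis (Fin n) ℂ F) :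
    Sym[ℂ]^n (E ⊗[ℂ] F) →ₗ[ℂ] (⨂[ℂ] _ : Fin n, E) ⊗[ℂ] (⨂[ℂ] _ : Fin n, F) :=
  symLift (∑ σ : Equiv.Perm (Fin n),
      ((splitTensor e f).compMultilinearMap (PiTensorProduct.tprod ℂ)).domDomCongr σ)
    (fun τ v => by
      simp only [sum_apply, MultilinearMap.domDomCongr_apply]
      exact Fintype.sum_equiv (Equiv.mulLeft τ) _ _ fun σ => rfl)

theorem polarization_symPairing (e : Module.Basis (Fin n) ℂ E) (f : Module.Basis (Fin n) ℂ F)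
    (x : ⨂[ℂ] _ : Fin n, E) (y : ⨂[ℂ] _ : Fin n, F) :
    polarization e f (symPairing n E F x y)
      = ∑ σ : Equiv.Perm (Fin n), placePerm E σ x ⊗ₜ[ℂ] placePerm F σ y := by
  have h : (symPairing n E F).compr₂ (polarization e f)
      = ∑ σ : Equiv.Perm (Fin n), (TensorProduct.mk ℂ (⨂[ℂ] _ : Fin n, E)
        (⨂[ℂ] _ : Fin n, F)).compl₁₂ (placePerm E σ) (placePerm F σ) := by
    refine (Basis.piTensorProduct fun _ : Fin n => e).ext fun k =>
      (Basis.piTensorProduct fun _ : Fin n => f).ext fun l => ?_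
    simp only [Basis.piTensorProduct_apply, LinearMap.compr₂_apply, LinearMap.sum_apply,
      LinearMap.compl₁₂_apply, symPairing_tprod, polarization, symLift_tprod,
      sum_apply, MultilinearMap.domDomCongr_apply, placePerm_tprod,
      LinearMap.compMultilinearMap_apply, TensorProduct.mk_apply]
    refine Finset.sum_congr rfl fun σ _ => ?_
    have hb : (PiTensorProduct.tprod ℂ fun i => e (k (σ i)) ⊗ₜ[ℂ] f (l (σ i)))
        = (Basis.piTensorProduct fun _ : Fin n => e.tensorProduct f)
          fun i => (k (σ i), l (σ i)) := by
      simp [Module.Basis.tensorProduct_apply]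
    rw [hb, splitTensor, Module.Basis.constr_basis]
  have h' := LinearMap.congr_fun₂ h x y
  simpa [LinearMap.sum_apply] using h'

end Pairing

/-! ### The group algebra inside Sⁿ(E ⊗ F), and the immanant as a class function. -/

section Orbit

open MonoidAlgebra

variable {n : ℕ} {μ : YoungDiagram} {E F : Type*} [AddCommGroup E] [Module ℂ E]
  [AddCommGroup F] [Module ℂ F]

/-- The tensor `e₁ ⊗ ⋯ ⊗ eₙ`. -/
def baseTensor (e : Module.Basis (Fin n) ℂ E) : ⨂[ℂ] _ : Fin n, E :=
  PiTensorProduct.tprod ℂ e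

theorem placePerm_baseTensor (e : Module.Basis (Fin n) ℂ E) (σ : Equiv.Perm (Fin n)) :
    placePerm E σ (baseTensor e) = PiTensorProduct.tprod ℂ fun i => e (σ i) :=
  placePerm_tprod _ _

theorem tensorPowerRep_diagonal_tprod (e : Module.Basis (Fin n) ℂ E) (a : Fin n → ℂˣ)
    (k : Fin n → Fin n) :
    tensorPowerRep E n (diagonal e a) (PiTensorProduct.tprod ℂ fun i => e (k i))
      = (∏ i, (a (k i) : ℂ)) • PiTensorProduct.tprod ℂ fun i => e (k i) := by
  rw [tensorPowerRep_tprod]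
  simp only [diagonal_apply]
  exact MultilinearMap.map_smul_univ _ _ _

theorem tensorPowerRep_diagonal_baseTensor (e : Module.Basis (Fin n) ℂ E) {a : Fin n → ℂˣ}
    (ha : ∏ i, a i = 1) : tensorPowerRep E n (diagonal e a) (baseTensor e) = baseTensor e := by
  have h := tensorPowerRep_diagonal_tprod e a id
  simp only [id_eq] at h
  rw [← Units.coe_prod, ha, Units.val_one, one_smul] at h
  exact h

theorem tensorPowerRep_permutation_baseTensor (e : Module.Basis (Fin n) ℂ E)
    (σ : Equiv.Perm (Fin n)) :
    tensorPowerRep E n (permutation e σ) (baseTensor e) = placePerm E σ (baseTensor e) := by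
  rw [placePerm_baseTensor, baseTensor, tensorPowerRep_tprod]
  simp only [permutation_apply]

/-- The linear map from the group algebra to `S^n(E ⊗ F)` that sends `σ` to `∏ eᵢ ⊗ f_{σ(i)}`. -/
def orbitMap (e : Module.Basis (Fin n) ℂ E) (f : Module.Basis (Fin n) ℂ F) :
    MonoidAlgebra ℂ (Equiv.Perm (Fin n)) →ₗ[ℂ] Sym[ℂ]^n (E ⊗[ℂ] F) where
  toFun a := symPairing n E F (baseTensor e) (placeAction F a (baseTensor f))
  map_add' a b := by rw [placeAction_add, map_add]
  map_smul' t a := by rw [placeAction_smul, map_smul, RingHom.id_apply]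

theorem orbitMap_apply (e : Module.Basis (Fin n) ℂ E) (f : Module.Basis (Fin n) ℂ F)
    (a : MonoidAlgebra ℂ (Equiv.Perm (Fin n))) :
    orbitMap e f a = symPairing n E F (baseTensor e) (placeAction F a (baseTensor f)) := rfl

theorem orbitMap_of (e : Module.Basis (Fin n) ℂ E) (f : Module.Basis (Fin n) ℂ F)
    (σ : Equiv.Perm (Fin n)) :
    orbitMap e f (of ℂ _ σ) = SymmetricPower.tprod ℂ fun i => e i ⊗ₜ[ℂ] f (σ i) := by
  rw [orbitMap_apply, placeAction_of, placePerm_baseTensor, baseTensor, symPairing_tprod]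

theorem symPairing_placeAction_baseTensor (e : Module.Basis (Fin n) ℂ E)
    (f : Module.Basis (Fin n) ℂ F) (a b : MonoidAlgebra ℂ (Equiv.Perm (Fin n))) :
    symPairing n E F (placeAction E a (baseTensor e)) (placeAction F b (baseTensor f))
      = orbitMap e f (b * inversion n a) := by
  rw [symPairing_placeAction, orbitMap_apply, placeAction_mul]

theorem permRep_symPairing (e : Module.Basis (Fin n) ℂ E) (f : Module.Basis (Fin n) ℂ F)
    (σ : Equiv.Perm (Fin n)) (x : ⨂[ℂ] _ : Fin n, E) (y : ⨂[ℂ] _ : Fin n, F) :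
    permRep e f σ (symPairing n E F x y) = symPairing n E F
      (tensorPowerRep E n (permutation e σ) x) (tensorPowerRep F n (permutation f σ) y) :=
  symTensorRep_symPairing _ _ _

theorem tensorPowerRep_permutation_placeAction (e : Module.Basis (Fin n) ℂ E)
    (σ : Equiv.Perm (Fin n)) (a : MonoidAlgebra ℂ (Equiv.Perm (Fin n))) :
    tensorPowerRep E n (permutation e σ) (placeAction E a (baseTensor e))
      = placeAction E (of ℂ _ σ * a) (baseTensor e) := by
  rw [tensorPowerRep_placeAction, tensorPowerRep_permutation_baseTensor, placeAction_mul,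
    placeAction_of]

/-- Permuting each basis multiplies on the left by σ; moving the E-side factor across the pairing
turns it into σ⁻¹ on the right. -/
theorem permRep_orbitMap (e : Module.Basis (Fin n) ℂ E) (f : Module.Basis (Fin n) ℂ F)
    (σ : Equiv.Perm (Fin n)) (a : MonoidAlgebra ℂ (Equiv.Perm (Fin n))) :
    permRep e f σ (orbitMap e f a) = orbitMap e f (of ℂ _ σ * a * of ℂ _ σ⁻¹) := by
  rw [orbitMap_apply, permRep_symPairing, tensorPowerRep_permutation_placeAction,
    tensorPowerRep_permutation_baseTensor, ← placeAction_of, symPairing_placeAction_baseTensor,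
    inversion_of]

theorem sum_permRep_orbitMap (e : Module.Basis (Fin n) ℂ E) (f : Module.Basis (Fin n) ℂ F)
    (a : MonoidAlgebra ℂ (Equiv.Perm (Fin n))) :
    ∑ σ, permRep e f σ (orbitMap e f a) = orbitMap e f (conjSum n a) := by
  simp only [permRep_orbitMap, conjSum_apply, map_sum]

theorem permRep_orbitMap_conjSum (e : Module.Basis (Fin n) ℂ E) (f : Module.Basis (Fin n) ℂ F)
    (σ : Equiv.Perm (Fin n)) (a : MonoidAlgebra ℂ (Equiv.Perm (Fin n))) :
    permRep e f σ (orbitMap e f (conjSum n a)) = orbitMap e f (conjSum n a) := by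
  rw [← sum_permRep_orbitMap, map_sum]
  exact Fintype.sum_equiv (Equiv.mulLeft σ) _ _ fun τ => by simp

theorem immanant_eq_orbitMap (e : Module.Basis (Fin n) ℂ E) (f : Module.Basis (Fin n) ℂ F)
    (T : Fin n ≃ μ.cells) : immanant e f T = orbitMap e f (characterSum T) := by
  rw [immanant, characterSum, map_sum]
  refine Finset.sum_congr rfl fun σ _ => ?_
  rw [← orbitMap_of, ← map_smul]
  simp

theorem exists_smul_immanant (e : Module.Basis (Fin n) ℂ E) (f : Module.Basis (Fin n) ℂ F)
    (T : Fin n ≃ μ.cells) : ∃ t : ℂ, t ≠ 0 ∧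
      t • immanant e f T = orbitMap e f (conjSum n (youngSymmetrizer T)) := by
  obtain ⟨t, ht0, ht⟩ := exists_youngSymmetrizer_sq T
  exact ⟨t, Complex.ofReal_ne_zero.2 ht0,
    by rw [immanant_eq_orbitMap, ← map_smul, smul_characterSum T ht]⟩

theorem permRep_immanant (e : Module.Basis (Fin n) ℂ E) (f : Module.Basis (Fin n) ℂ F)
    (T : Fin n ≃ μ.cells) (σ : Equiv.Perm (Fin n)) :
    permRep e f σ (immanant e f T) = immanant e f T := by
  obtain ⟨t, ht0, ht⟩ := exists_smul_immanant e f T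
  have h := permRep_orbitMap_conjSum e f σ (youngSymmetrizer T)
  rw [← ht, map_smul] at h
  exact smul_right_injective _ ht0 h

theorem evalIdentity_immanant (e : Module.Basis (Fin n) ℂ E) (f : Module.Basis (Fin n) ℂ F)
    (T : Fin n ≃ μ.cells) :
    evalIdentity e f (immanant e f T) = (Module.finrank ℂ (specht T).toSubmodule : ℂ) := by
  rw [evalIdentity, toPoly_immanant, immanantPoly, map_sum, ← spechtCharacter_one,
    Finset.sum_eq_single 1]
  · simp
  · intro σ _ hσ
    obtain ⟨i, hi⟩ : ∃ i, σ i ≠ i := by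
      by_contra! h
      exact hσ (Equiv.ext h)
    rw [map_mul, map_prod, Finset.prod_eq_zero (Finset.mem_univ i), mul_zero]
    simp [Matrix.one_apply_ne hi.symm]
  · simp

theorem evalIdentity_smul (e : Module.Basis (Fin n) ℂ E) (f : Module.Basis (Fin n) ℂ F)
    (t : ℂ) (Q : Sym[ℂ]^n (E ⊗[ℂ] F)) :
    evalIdentity e f (t • Q) = t * evalIdentity e f Q := by
  simp [evalIdentity, MvPolynomial.smul_eval]

theorem immanant_ne_zero (e : Module.Basis (Fin n) ℂ E) (f : Module.Basis (Fin n) ℂ F)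
    (T : Fin n ≃ μ.cells) : immanant e f T ≠ 0 := by
  intro h
  have h1 := evalIdentity_immanant e f T
  rw [h, ← zero_smul ℂ (0 : Sym[ℂ]^n (E ⊗[ℂ] F)), evalIdentity_smul, zero_mul] at h1
  exact finrank_specht_ne_zero T h1.symm

end Orbit

/-! ### Equivariant bilinear maps come from the group algebra. -/

section Equivariant

open MonoidAlgebra

variable {n : ℕ} {E F : Type*} [AddCommGroup E] [Module ℂ E] [AddCommGroup F] [Module ℂ F]

/-- A vector of `S^n(E ⊗ F)` of weight zero for both groups is in the image of the group
algebra. -/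
theorem mem_range_orbitMap (e : Module.Basis (Fin n) ℂ E) (f : Module.Basis (Fin n) ℂ F)
    {z : Sym[ℂ]^n (E ⊗[ℂ] F)}
    (hE : z ∈ weightZero e ((symTensorRep n E F).comp (MonoidHom.inl _ _)))
    (hF : z ∈ weightZero f ((symTensorRep n E F).comp (MonoidHom.inr _ _))) :
    z ∈ LinearMap.range (orbitMap e f) := by
  have h0 : z ∈ Submodule.span ℂ ((fun k : (Fin n → Fin n) × (Fin n → Fin n) =>
      symPairing n E F (PiTensorProduct.tprod ℂ fun i => e (k.1 i))
        (PiTensorProduct.tprod ℂ fun i => f (k.2 i))) '' Set.univ) := by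
    rw [Set.image_univ, span_symPairing_basis]
    exact Submodule.mem_top
  -- The torus on the E side leaves only products with bijective e-indices; the torus on the F side
  -- then does the same for the f-indices.
  have h1 := mem_span_of_mem_weightZero e _ _ (fun k => k.1) (fun a k => by
    simp [symTensorRep_symPairing, tensorPowerRep_diagonal_tprod]) _ h0 hE
  have h2 := mem_span_of_mem_weightZero f _ _ (fun k => k.2) (fun a k => by
    simp [symTensorRep_symPairing, tensorPowerRep_diagonal_tprod]) _ h1 hF
  refine Submodule.span_le.2 ?_ h2
  rintro _ ⟨⟨k, l⟩, ⟨⟨-, hk⟩, hl⟩, rfl⟩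
  refine ⟨of ℂ _ (Equiv.ofBijective l hl) * inversion n (of ℂ _ (Equiv.ofBijective k hk)), ?_⟩
  rw [← symPairing_placeAction_baseTensor, placeAction_of, placeAction_of, placePerm_baseTensor,
    placePerm_baseTensor]
  rfl

/-- Equivariant bilinear maps from the tensor powers to `S^n(E ⊗ F)` come from the group
algebra. -/
theorem exists_placeAction_of_equivariant (e : Module.Basis (Fin n) ℂ E)
    (f : Module.Basis (Fin n) ℂ F)
    (B : (⨂[ℂ] _ : Fin n, E) →ₗ[ℂ] (⨂[ℂ] _ : Fin n, F) →ₗ[ℂ] Sym[ℂ]^n (E ⊗[ℂ] F))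
    (hB : ∀ g x y, symTensorRep n E F g (B x y)
      = B (tensorPowerRep E n g.1 x) (tensorPowerRep F n g.2 y)) :
    ∃ a, ∀ x y, B x y = symPairing n E F x (placeAction F a y) := by
  obtain ⟨a, ha⟩ : B (baseTensor e) (baseTensor f) ∈ LinearMap.range (orbitMap e f) := by
    refine mem_range_orbitMap e f (fun a ha => ?_) (fun a ha => ?_)
    · simp [hB, tensorPowerRep_diagonal_baseTensor e ha]
    · simp [hB, tensorPowerRep_diagonal_baseTensor f ha]
  refine ⟨a, fun x y => ?_⟩
  rw [orbitMap_apply] at ha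
  -- Equivariance carries the equality from the fixed pair of bases to all pairs of bases; density
  -- then frees first the vectors of E and next those of F.
  have h0 (g : LinearMap.GeneralLinearGroup ℂ E) (h : LinearMap.GeneralLinearGroup ℂ F) :
      B (PiTensorProduct.tprod ℂ fun i => naturalRep E g (e i))
          (PiTensorProduct.tprod ℂ fun i => naturalRep F h (f i))
        = symPairing n E F (PiTensorProduct.tprod ℂ fun i => naturalRep E g (e i))
          (placeAction F a (PiTensorProduct.tprod ℂ fun i => naturalRep F h (f i))) := by
    rw [← tensorPowerRep_tprod, ← tensorPowerRep_tprod, ← tensorPowerRep_placeAction,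
      ← hB (g, h), ← symTensorRep_symPairing (g, h)]
    exact congrArg _ ha.symm
  let D := (symPairing n E F).compl₂ (placeAction F a)
  have h1 (h : LinearMap.GeneralLinearGroup ℂ F) (v : Fin n → E) :
      B (PiTensorProduct.tprod ℂ v) (PiTensorProduct.tprod ℂ fun i => naturalRep F h (f i))
        = D (PiTensorProduct.tprod ℂ v)
          (PiTensorProduct.tprod ℂ fun i => naturalRep F h (f i)) :=
    DFunLike.congr_fun (multilinearMap_ext_bases e
      (f := (B.flip (PiTensorProduct.tprod ℂ fun i => naturalRep F h (f i))).compMultilinearMap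
        (PiTensorProduct.tprod ℂ))
      (f' := (D.flip (PiTensorProduct.tprod ℂ fun i => naturalRep F h (f i))).compMultilinearMap
        (PiTensorProduct.tprod ℂ)) fun g => h0 g h) v
  have h2 (v : Fin n → E) (w : Fin n → F) :
      B (PiTensorProduct.tprod ℂ v) (PiTensorProduct.tprod ℂ w)
        = D (PiTensorProduct.tprod ℂ v) (PiTensorProduct.tprod ℂ w) :=
    DFunLike.congr_fun (multilinearMap_ext_bases f
      (f := (B (PiTensorProduct.tprod ℂ v)).compMultilinearMap (PiTensorProduct.tprod ℂ))
      (f' := (D (PiTensorProduct.tprod ℂ v)).compMultilinearMap (PiTensorProduct.tprod ℂ))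
      fun h => h1 h v) w
  exact LinearMap.congr_fun₂ (tensorPower_ext₂ (B' := D) h2) x y

end Equivariant

/-! ### The summand U_π: existence and uniqueness. -/

section SchurPairing

open MonoidAlgebra

variable {n : ℕ} {μ : YoungDiagram} {E F : Type*} [AddCommGroup E] [Module ℂ E]
  [AddCommGroup F] [Module ℂ F]

/-- The map `S_π(E) ⊗ S_π(F) → S^n(E ⊗ F)` induced by the pairing of tensor powers. -/
def schurPairing (E F : Type*) [AddCommGroup E] [Module ℂ E] [AddCommGroup F] [Module ℂ F]
    (T : Fin n ≃ μ.cells) :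
    (schur E T).toSubmodule ⊗[ℂ] (schur F T).toSubmodule →ₗ[ℂ] Sym[ℂ]^n (E ⊗[ℂ] F) :=
  TensorProduct.lift (symPairing n E F) ∘ₗ
    TensorProduct.mapIncl (schur E T).toSubmodule (schur F T).toSubmodule

theorem schurPairing_tmul (T : Fin n ≃ μ.cells) (x : (schur E T).toSubmodule)
    (y : (schur F T).toSubmodule) :
    schurPairing E F T (x ⊗ₜ y) = symPairing n E F x.1 y.1 := by
  simp [schurPairing, TensorProduct.mapIncl]

theorem schurTensor_tmul (T : Fin n ≃ μ.cells)
    (g : LinearMap.GeneralLinearGroup ℂ E × LinearMap.GeneralLinearGroup ℂ F)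
    (x : (schur E T).toSubmodule) (y : (schur F T).toSubmodule) :
    schurTensor E F T g (x ⊗ₜ y)
      = (schur E T).toRepresentation g.1 x ⊗ₜ (schur F T).toRepresentation g.2 y := rfl

theorem coe_schur_toRepresentation (T : Fin n ≃ μ.cells) (g : LinearMap.GeneralLinearGroup ℂ E)
    (x : (schur E T).toSubmodule) :
    ((schur E T).toRepresentation g x : ⨂[ℂ] _ : Fin n, E) = tensorPowerRep E n g x.1 := rfl

theorem schurPairing_equivariant (T : Fin n ≃ μ.cells)
    (g : LinearMap.GeneralLinearGroup ℂ E × LinearMap.GeneralLinearGroup ℂ F)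
    (z : (schur E T).toSubmodule ⊗[ℂ] (schur F T).toSubmodule) :
    schurPairing E F T (schurTensor E F T g z) = symTensorRep n E F g (schurPairing E F T z) := by
  induction z using TensorProduct.induction_on with
  | zero => simp
  | tmul x y =>
    rw [schurTensor_tmul, schurPairing_tmul, schurPairing_tmul, symTensorRep_symPairing,
      coe_schur_toRepresentation, coe_schur_toRepresentation]
  | add z w hz hw => simp only [map_add, hz, hw]

/-- The Schur module as a quotient of the tensor power. -/
def toSchur (E : Type*) [AddCommGroup E] [Module ℂ E] (T : Fin n ≃ μ.cells) :
    (⨂[ℂ] _ : Fin n, E) →ₗ[ℂ] (schur E T).toSubmodule :=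
  (placeAction E (youngSymmetrizer T)).rangeRestrict

theorem coe_toSchur (T : Fin n ≃ μ.cells) (x : ⨂[ℂ] _ : Fin n, E) :
    (toSchur E T x : ⨂[ℂ] _ : Fin n, E) = placeAction E (youngSymmetrizer T) x := rfl

theorem toSchur_surjective (T : Fin n ≃ μ.cells) : Function.Surjective (toSchur E T) :=
  LinearMap.surjective_rangeRestrict _

theorem toSchur_placeAction (T : Fin n ≃ μ.cells) {t : ℂ}
    (ht : youngSymmetrizer T * youngSymmetrizer T = t • youngSymmetrizer T)
    (x : ⨂[ℂ] _ : Fin n, E) :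
    toSchur E T (placeAction E (youngSymmetrizer T) x) = t • toSchur E T x := by
  refine Subtype.ext ?_
  rw [coe_toSchur, ← placeAction_mul, ht, placeAction_smul, Submodule.coe_smul, coe_toSchur]

theorem toRepresentation_toSchur (T : Fin n ≃ μ.cells) (g : LinearMap.GeneralLinearGroup ℂ E)
    (x : ⨂[ℂ] _ : Fin n, E) :
    (schur E T).toRepresentation g (toSchur E T x) = toSchur E T (tensorPowerRep E n g x) := by
  refine Subtype.ext ?_
  rw [coe_schur_toRepresentation, coe_toSchur, coe_toSchur, tensorPowerRep_placeAction]

theorem placeAction_placePerm_placeAction (T : Fin n ≃ μ.cells) {σ : Equiv.Perm (Fin n)} {t : ℂ}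
    (ht : youngSymmetrizer T * of ℂ _ σ * youngSymmetrizer T = t • youngSymmetrizer T)
    (x : ⨂[ℂ] _ : Fin n, E) :
    placeAction E (youngSymmetrizer T) (placePerm E σ (placeAction E (youngSymmetrizer T) x))
      = t • placeAction E (youngSymmetrizer T) x := by
  rw [← placeAction_of, ← placeAction_mul, ← placeAction_mul, ← mul_assoc, ht, placeAction_smul]

/-- Polarization sends the image of x ⊗ y to ∑ xσ ⊗ yσ. For x and y in the image of c, applying c to
both factors turns each term into t_σ² x ⊗ y, since cσc = t_σ c. The sum of the real squares t_σ² is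
positive because t₁ ≠ 0. -/
theorem schurPairing_injective (e : Module.Basis (Fin n) ℂ E) (f : Module.Basis (Fin n) ℂ F)
    (T : Fin n ≃ μ.cells) : Function.Injective (schurPairing E F T) := by
  choose t ht using youngSymmetrizer_of_youngSymmetrizer T
  obtain ⟨t1, ht1, hsq⟩ := exists_youngSymmetrizer_sq T
  have hE (σ : Equiv.Perm (Fin n)) (x : ⨂[ℂ] _ : Fin n, E) :=
    placeAction_placePerm_placeAction T (ht σ) x
  have hF (σ : Equiv.Perm (Fin n)) (y : ⨂[ℂ] _ : Fin n, F) :=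
    placeAction_placePerm_placeAction T (ht σ) y
  have hK (z : (schur E T).toSubmodule ⊗[ℂ] (schur F T).toSubmodule) :
      TensorProduct.map (placeAction E (youngSymmetrizer T)) (placeAction F (youngSymmetrizer T))
        (polarization e f (schurPairing E F T z))
      = ((∑ σ, t σ * t σ : ℝ) : ℂ) •
        TensorProduct.mapIncl (schur E T).toSubmodule (schur F T).toSubmodule z := by
    induction z using TensorProduct.induction_on with
    | zero => simp
    | tmul x y =>
      obtain ⟨_, x, rfl⟩ := x
      obtain ⟨_, y, rfl⟩ := y
      rw [schurPairing_tmul, polarization_symPairing, map_sum]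
      simp only [TensorProduct.map_tmul, hE, hF, TensorProduct.mapIncl, Submodule.subtype_apply,
        TensorProduct.smul_tmul_smul]
      push_cast
      rw [Finset.sum_smul]
    | add z w hz hw => simp only [map_add, hz, hw, smul_add]
  have h0 : ((∑ σ, t σ * t σ : ℝ) : ℂ) ≠ 0 := by
    rw [Complex.ofReal_ne_zero]
    refine ne_of_gt (Finset.sum_pos' (fun σ _ => mul_self_nonneg _) ⟨1, Finset.mem_univ _, ?_⟩)
    refine mul_self_pos.2 fun h1 => ?_
    have h2 := ht 1
    have h3 := youngSymmetrizer_coeff_one T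
    rw [map_one, mul_one, hsq, h1] at h2
    have h4 := congrArg (fun x => x.coeff 1) h2
    simp [h3] at h4
    exact ht1 h4
  have hincl : Function.Injective
      (TensorProduct.mapIncl (schur E T).toSubmodule (schur F T).toSubmodule) :=
    TensorProduct.map_injective_of_flat_flat _ _ (Submodule.subtype_injective _)
      (Submodule.subtype_injective _)
  intro z w hzw
  have h := hK z
  rw [hzw, hK w] at h
  exact hincl (smul_right_injective _ h0 h.symm)

/-- The equivariant maps `S_π(E) ⊗ S_π(F) → S^n(E ⊗ F)` are the multiples of the standard one. -/
theorem exists_eq_smul_schurPairing (e : Module.Basis (Fin n) ℂ E) (f : Module.Basis (Fin n) ℂ F)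
    (T : Fin n ≃ μ.cells)
    (ψ : (schur E T).toSubmodule ⊗[ℂ] (schur F T).toSubmodule →ₗ[ℂ] Sym[ℂ]^n (E ⊗[ℂ] F))
    (hψ : ∀ g z, ψ (schurTensor E F T g z) = symTensorRep n E F g (ψ z)) :
    ∃ t : ℂ, ψ = t • schurPairing E F T := by
  obtain ⟨t, ht0, ht⟩ := exists_youngSymmetrizer_sq T
  have ht0' : (t : ℂ) ≠ 0 := Complex.ofReal_ne_zero.2 ht0
  obtain ⟨a, ha⟩ := exists_placeAction_of_equivariant e f
    (((TensorProduct.mk ℂ _ _).compl₁₂ (toSchur E T) (toSchur F T)).compr₂ ψ) (fun g x y => by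
      simp only [LinearMap.compr₂_apply, LinearMap.compl₁₂_apply, TensorProduct.mk_apply]
      rw [← hψ, schurTensor_tmul, toRepresentation_toSchur, toRepresentation_toSchur])
  simp only [LinearMap.compr₂_apply, LinearMap.compl₁₂_apply, TensorProduct.mk_apply] at ha
  obtain ⟨u, hu⟩ := youngSymmetrizer_mul_mul_inversion T a
  refine ⟨((t : ℂ) * t)⁻¹ * u, TensorProduct.ext' fun x y => ?_⟩
  obtain ⟨x, rfl⟩ := toSchur_surjective T x
  obtain ⟨y, rfl⟩ := toSchur_surjective T y
  -- With xc and yc as arguments the left side gains the factor t², while on the right c crosses the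
  -- pairing and produces cac*, a multiple of cc*.
  have h := ha (placeAction E (youngSymmetrizer T) x) (placeAction F (youngSymmetrizer T) y)
  rw [toSchur_placeAction T ht, toSchur_placeAction T ht, TensorProduct.smul_tmul_smul, map_smul,
    symPairing_placeAction, ← placeAction_mul, ← placeAction_mul, ← mul_assoc, hu,
    placeAction_smul, map_smul, placeAction_mul, ← symPairing_placeAction] at h
  rw [LinearMap.smul_apply, schurPairing_tmul, coe_toSchur, coe_toSchur, mul_smul, ← h, smul_smul,
    inv_mul_cancel₀ (mul_ne_zero ht0' ht0'), one_smul]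

/-- The summand of `S^n(E ⊗ F)` that belongs to the shape of `T`. -/
def cauchySummand (E F : Type*) [AddCommGroup E] [Module ℂ E] [AddCommGroup F] [Module ℂ F]
    (T : Fin n ≃ μ.cells) : Subrepresentation (symTensorRep n E F) where
  toSubmodule := LinearMap.range (schurPairing E F T)
  apply_mem_toSubmodule := by
    rintro g _ ⟨z, rfl⟩
    exact ⟨_, schurPairing_equivariant T g z⟩

theorem isCopyOf_cauchySummand (e : Module.Basis (Fin n) ℂ E) (f : Module.Basis (Fin n) ℂ F)
    (T : Fin n ≃ μ.cells) : IsCopyOf (schurTensor E F T) (cauchySummand E F T) :=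
  ⟨Representation.Equiv.mk
    (LinearEquiv.ofInjective (schurPairing E F T) (schurPairing_injective e f T))
    fun g => LinearMap.ext fun z => Subtype.ext (schurPairing_equivariant T g z)⟩

theorem subtype_comp_equiv_eq_smul (e : Module.Basis (Fin n) ℂ E) (f : Module.Basis (Fin n) ℂ F)
    (T : Fin n ≃ μ.cells) (U : Subrepresentation (symTensorRep n E F))
    (φ : (schurTensor E F T).Equiv U.toRepresentation) :
    ∃ t : ℂ, U.toSubmodule.subtype ∘ₗ φ.toLinearMap = t • schurPairing E F T :=
  exists_eq_smul_schurPairing e f T _ fun g z =>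
    congrArg Subtype.val (Representation.IntertwiningMap.isIntertwining _ _ φ.toIntertwiningMap g z)

theorem range_subtype_comp_equiv (T : Fin n ≃ μ.cells)
    (U : Subrepresentation (symTensorRep n E F))
    (φ : (schurTensor E F T).Equiv U.toRepresentation) :
    LinearMap.range (U.toSubmodule.subtype ∘ₗ φ.toLinearMap) = U.toSubmodule := by
  rw [LinearMap.range_comp, LinearMap.range_eq_top.2 φ.toLinearEquiv.surjective,
    Submodule.map_top, Submodule.range_subtype]

theorem isCopyOf_schurTensor_iff (e : Module.Basis (Fin n) ℂ E) (f : Module.Basis (Fin n) ℂ F)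
    (T : Fin n ≃ μ.cells) (U : Subrepresentation (symTensorRep n E F)) :
    IsCopyOf (schurTensor E F T) U ↔ U = cauchySummand E F T := by
  constructor
  · rintro ⟨φ⟩
    obtain ⟨t, ht⟩ := subtype_comp_equiv_eq_smul e f T U φ
    refine Subrepresentation.toSubmodule_injective ?_
    rw [← range_subtype_comp_equiv T U φ, ht]
    change _ = LinearMap.range (schurPairing E F T)
    -- If t = 0, injectivity of φ makes the source zero, and both ranges vanish.
    by_cases h : t = 0
    · have hz (z : (schur E T).toSubmodule ⊗[ℂ] (schur F T).toSubmodule) : z = 0 := by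
        have h1 := LinearMap.congr_fun ht z
        rw [h, zero_smul] at h1
        exact φ.toLinearEquiv.map_eq_zero_iff.1 (Subtype.ext h1)
      have hs : schurPairing E F T = 0 := LinearMap.ext fun z => by rw [hz z, map_zero, map_zero]
      rw [hs, smul_zero]
    · exact LinearMap.range_smul _ _ h
  · rintro rfl
    exact isCopyOf_cauchySummand e f T

end SchurPairing

/-! ### The weight-zero part of U_π and its invariant line. -/

section WeightZero

open MonoidAlgebra

variable {n : ℕ} {μ : YoungDiagram} {E F : Type*} [AddCommGroup E] [Module ℂ E]
  [AddCommGroup F] [Module ℂ F]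

/-- The basis tensors that survive the torus are those whose indices form a permutation, that is,
the place permutations of e₁ ⊗ ⋯ ⊗ eₙ. -/
theorem exists_placeAction_of_mem_weightZero (e : Module.Basis (Fin n) ℂ E)
    {x : ⨂[ℂ] _ : Fin n, E} (hx : x ∈ weightZero e (tensorPowerRep E n)) :
    ∃ a, x = placeAction E a (baseTensor e) := by
  have h0 : x ∈ Submodule.span ℂ ((fun k : Fin n → Fin n =>
      PiTensorProduct.tprod ℂ fun i => e (k i)) '' Set.univ) := by
    have h := (Basis.piTensorProduct fun _ : Fin n => e).mem_span x
    simpa only [Set.image_univ, Basis.piTensorProduct_apply, funext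
      (Basis.piTensorProduct_apply fun _ : Fin n => e)] using h
  have h1 := mem_span_of_mem_weightZero e _ _ id
    (fun a k => tensorPowerRep_diagonal_tprod e a k) _ h0 hx
  let L : MonoidAlgebra ℂ (Equiv.Perm (Fin n)) →ₗ[ℂ] ⨂[ℂ] _ : Fin n, E :=
    { toFun := fun a => placeAction E a (baseTensor e)
      map_add' := fun a b => placeAction_add a b _
      map_smul' := fun t a => placeAction_smul t a _ }
  have hL : x ∈ LinearMap.range L := by
    refine Submodule.span_le.2 ?_ h1
    rintro _ ⟨k, ⟨-, hk⟩, rfl⟩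
    exact ⟨of ℂ _ (Equiv.ofBijective k hk), (placeAction_of _ _).trans (placePerm_baseTensor _ _)⟩
  obtain ⟨a, ha⟩ := hL
  exact ⟨a, ha.symm⟩

theorem toSchur_mem_weightZero (e : Module.Basis (Fin n) ℂ E) (T : Fin n ≃ μ.cells)
    (a : MonoidAlgebra ℂ (Equiv.Perm (Fin n))) :
    toSchur E T (placeAction E a (baseTensor e))
      ∈ weightZero e (schur E T).toRepresentation := fun d hd => by
  rw [toRepresentation_toSchur, tensorPowerRep_placeAction, tensorPowerRep_diagonal_baseTensor e hd]

/-- On the Schur module c acts as the nonzero scalar t, so a vector already written as (e₁ ⊗ ⋯ ⊗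
eₙ)·a equals t⁻¹(e₁ ⊗ ⋯ ⊗ eₙ)·ac. -/
theorem exists_toSchur_of_mem_weightZero (e : Module.Basis (Fin n) ℂ E) (T : Fin n ≃ μ.cells)
    {x : (schur E T).toSubmodule} (hx : x ∈ weightZero e (schur E T).toRepresentation) :
    ∃ a, x = toSchur E T (placeAction E a (baseTensor e)) := by
  obtain ⟨t, ht0, ht⟩ := exists_youngSymmetrizer_sq T
  obtain ⟨a, ha⟩ := exists_placeAction_of_mem_weightZero e (x := x.1)
    fun d hd => congrArg Subtype.val (hx d hd)
  obtain ⟨y, rfl⟩ := toSchur_surjective T x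
  refine ⟨(t : ℂ)⁻¹ • a, ?_⟩
  rw [placeAction_smul, ← ha, map_smul, coe_toSchur, toSchur_placeAction T ht, smul_smul,
    inv_mul_cancel₀ (Complex.ofReal_ne_zero.2 ht0), one_smul]

theorem schurPairing_toSchur (e : Module.Basis (Fin n) ℂ E) (f : Module.Basis (Fin n) ℂ F)
    (T : Fin n ≃ μ.cells) (a b : MonoidAlgebra ℂ (Equiv.Perm (Fin n))) :
    schurPairing E F T (toSchur E T (placeAction E a (baseTensor e)) ⊗ₜ
        toSchur F T (placeAction F b (baseTensor f)))
      = orbitMap e f (b * youngSymmetrizer T * inversion n (youngSymmetrizer T) * inversion n a) := by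
  rw [schurPairing_tmul, coe_toSchur, coe_toSchur, symPairing_placeAction, ← placeAction_mul,
    ← placeAction_mul, symPairing_placeAction_baseTensor]
  simp only [mul_assoc]

/-- The sum over the symmetric group of the translates of a vector in the image of
`S_π(E)_0 ⊗ S_π(F)_0` is a multiple of the immanant. -/
theorem exists_sum_permRep_eq_smul (e : Module.Basis (Fin n) ℂ E) (f : Module.Basis (Fin n) ℂ F)
    (T : Fin n ≃ μ.cells) {Q : Sym[ℂ]^n (E ⊗[ℂ] F)}
    (hQ : Q ∈ (weightZeroTensor e f T).map (schurPairing E F T)) :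
    ∃ t : ℂ, ∑ σ, permRep e f σ Q = t • immanant e f T := by
  obtain ⟨u, -, hu⟩ := exists_smul_immanant e f T
  obtain ⟨_, ⟨z, rfl⟩, rfl⟩ := hQ
  induction z using TensorProduct.induction_on with
  | zero => exact ⟨0, by simp⟩
  | tmul x y =>
    obtain ⟨x, hx⟩ := x
    obtain ⟨y, hy⟩ := y
    obtain ⟨a, rfl⟩ := exists_toSchur_of_mem_weightZero e T hx
    obtain ⟨b, rfl⟩ := exists_toSchur_of_mem_weightZero f T hy
    -- The conjugation sum of bcc*a* is that of its rotation a*bcc*.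
    obtain ⟨t, ht⟩ := exists_conjSum_eq_smul T (inversion n a * b)
    refine ⟨t * u, ?_⟩
    rw [TensorProduct.mapIncl, TensorProduct.map_tmul, Submodule.subtype_apply,
      Submodule.subtype_apply, schurPairing_toSchur, sum_permRep_orbitMap, conjSum_mul_comm,
      ← mul_assoc, ← mul_assoc, ht, map_smul, ← hu, smul_smul]
  | add z w hz hw =>
    obtain ⟨t, ht⟩ := hz
    obtain ⟨s, hs⟩ := hw
    exact ⟨t + s, by simp only [map_add, Finset.sum_add_distrib, ht, hs, add_smul]⟩

/-- The immanant is a multiple of the sum over τ of the images of τCcc*τ⁻¹, and each of these is the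
pairing of the weight-zero vectors given by τ and τC. -/
theorem immanant_mem_map_weightZeroTensor (e : Module.Basis (Fin n) ℂ E)
    (f : Module.Basis (Fin n) ℂ F) (T : Fin n ≃ μ.cells) :
    immanant e f T ∈ (weightZeroTensor e f T).map (schurPairing E F T) := by
  obtain ⟨u, hu0, hu⟩ := exists_smul_immanant e f T
  obtain ⟨t, ht⟩ := exists_conjSum_youngSymmetrizer_eq_smul T
  rw [← Submodule.smul_mem_iff _ hu0, hu, ht, map_smul, conjSum_apply, map_sum]
  refine Submodule.smul_mem _ _ (Submodule.sum_mem _ fun τ _ => ?_)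
  have h := schurPairing_toSchur e f T (of ℂ _ τ) (of ℂ _ τ * colSum T)
  rw [inversion_of] at h
  rw [← mul_assoc, ← mul_assoc, ← h]
  refine Submodule.mem_map_of_mem ⟨⟨_, toSchur_mem_weightZero e T (of ℂ _ τ)⟩ ⊗ₜ
    ⟨_, toSchur_mem_weightZero f T (of ℂ _ τ * colSum T)⟩, ?_⟩
  rw [TensorProduct.mapIncl, TensorProduct.map_tmul]
  rfl

theorem weightZeroImage_eq (e : Module.Basis (Fin n) ℂ E) (f : Module.Basis (Fin n) ℂ F)
    (T : Fin n ≃ μ.cells) (φ : (schurTensor E F T).Equiv (cauchySummand E F T).toRepresentation) :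
    weightZeroImage e f T (cauchySummand E F T) φ
      = (weightZeroTensor e f T).map (schurPairing E F T) := by
  obtain ⟨t, ht⟩ := subtype_comp_equiv_eq_smul e f T _ φ
  -- Otherwise U_π would be zero, yet it contains the nonzero immanant.
  have ht0 : t ≠ 0 := by
    rintro rfl
    have h := range_subtype_comp_equiv T _ φ
    rw [ht, zero_smul, LinearMap.range_zero] at h
    obtain ⟨z, -, hz⟩ := immanant_mem_map_weightZeroTensor e f T
    have hz' : immanant e f T ∈ (cauchySummand E F T).toSubmodule := ⟨z, hz⟩
    rw [← h, Submodule.mem_bot] at hz'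
    exact immanant_ne_zero e f T hz'
  rw [weightZeroImage, ht, Submodule.map_smul _ _ _ ht0]

/-- The line spanned by the immanant. -/
def immanantLine (e : Module.Basis (Fin n) ℂ E) (f : Module.Basis (Fin n) ℂ F)
    (T : Fin n ≃ μ.cells) : Subrepresentation (permRep e f) where
  toSubmodule := Submodule.span ℂ {immanant e f T}
  apply_mem_toSubmodule σ v hv := by
    obtain ⟨t, rfl⟩ := Submodule.mem_span_singleton.1 hv
    rw [map_smul, permRep_immanant]
    exact hv

theorem isCopyOf_trivial_immanantLine (e : Module.Basis (Fin n) ℂ E)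
    (f : Module.Basis (Fin n) ℂ F) (T : Fin n ≃ μ.cells) :
    IsCopyOf (Representation.trivial ℂ (Equiv.Perm (Fin n)) ℂ) (immanantLine e f T) :=
  ⟨Representation.Equiv.mk
    (LinearEquiv.toSpanNonzeroSingleton ℂ _ _ (immanant_ne_zero e f T))
    fun σ => LinearMap.ext fun t => Subtype.ext (by
      change t • immanant e f T = permRep e f σ (t • immanant e f T)
      rw [map_smul, permRep_immanant])⟩

/-- The line spanned by the immanant is the only trivial subrepresentation of the image of
`S_π(E)_0 ⊗ S_π(F)_0`. -/
theorem isCopyOf_trivial_iff (e : Module.Basis (Fin n) ℂ E) (f : Module.Basis (Fin n) ℂ F)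
    (T : Fin n ≃ μ.cells) (C : Subrepresentation (permRep e f)) :
    (IsCopyOf (Representation.trivial ℂ (Equiv.Perm (Fin n)) ℂ) C ∧
      C.toSubmodule ≤ (weightZeroTensor e f T).map (schurPairing E F T)) ↔
      C = immanantLine e f T := by
  constructor
  · rintro ⟨⟨φ⟩, hC⟩
    set Q := φ 1
    have hinv (σ : Equiv.Perm (Fin n)) : permRep e f σ Q.1 = Q.1 :=
      (congrArg Subtype.val
        (Representation.IntertwiningMap.isIntertwining _ _ φ.toIntertwiningMap σ 1)).symm
    have hQ0 : Q.1 ≠ 0 := fun h =>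
      one_ne_zero (φ.toLinearEquiv.map_eq_zero_iff.1 (Subtype.ext h))
    obtain ⟨t, ht⟩ := exists_sum_permRep_eq_smul e f T (hC Q.2)
    -- An invariant Q equals each of its n! translates, so n!·Q is a multiple of the immanant.
    simp only [hinv, Finset.sum_const, ← Nat.cast_smul_eq_nsmul ℂ] at ht
    have hcard : ((Finset.univ : Finset (Equiv.Perm (Fin n))).card : ℂ) ≠ 0 :=
      Nat.cast_ne_zero.2 (Finset.card_ne_zero.2 Finset.univ_nonempty)
    have ht0 : t ≠ 0 := by
      rintro rfl
      rw [zero_smul] at ht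
      exact hQ0 ((smul_eq_zero_iff_right hcard).1 ht)
    have hspan : C.toSubmodule = Submodule.span ℂ {Q.1} := by
      refine le_antisymm (fun x hx => ?_) ((Submodule.span_singleton_le_iff_mem _ _).2 Q.2)
      obtain ⟨s, hs⟩ := φ.toLinearEquiv.surjective ⟨x, hx⟩
      refine Submodule.mem_span_singleton.2 ⟨s, ?_⟩
      have h := φ.toLinearEquiv.map_smul s 1
      rw [smul_eq_mul, mul_one, hs] at h
      exact (congrArg Subtype.val h).symm
    refine Subrepresentation.toSubmodule_injective ?_
    change _ = Submodule.span ℂ {immanant e f T}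
    rw [hspan, ← Submodule.span_singleton_smul_eq (IsUnit.mk0 _ hcard), ht,
      Submodule.span_singleton_smul_eq (IsUnit.mk0 _ ht0)]
  · rintro rfl
    exact ⟨isCopyOf_trivial_immanantLine e f T,
      (Submodule.span_singleton_le_iff_mem _ _).2 (immanant_mem_map_weightZeroTensor e f T)⟩

end WeightZero

end Immanant

end

/-! ### The main theorem. -/

open Immanant in
theorem mainTheorem3 {n : ℕ} {E F : Type*} [AddCommGroup E] [Module ℂ E] [AddCommGroup F]
    [Module ℂ F] (e : Module.Basis (Fin n) ℂ E) (f : Module.Basis (Fin n) ℂ F)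
    (μ : YoungDiagram) (T : Fin n ≃ μ.cells) :
    ∃ (U : Subrepresentation (symTensorRep n E F)) (C : Subrepresentation (permRep e f)),
      -- `U` is the only copy of `S_π(E) ⊗ S_π(F)` inside `S^n(E ⊗ F)`
      (∀ U' : Subrepresentation (symTensorRep n E F),
        IsCopyOf (schurTensor E F T) U' ↔ U' = U) ∧
      -- `C` is the only copy of the trivial representation inside `S_π(E)_0 ⊗ S_π(F)_0`
      (∀ φ : (schurTensor E F T).Equiv U.toRepresentation,
        ∀ C' : Subrepresentation (permRep e f),
          (IsCopyOf (Representation.trivial ℂ (Equiv.Perm (Fin n)) ℂ) C' ∧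
            C'.toSubmodule ≤ weightZeroImage e f T U φ) ↔ C' = C) ∧
      immanant e f T ∈ C ∧
      immanant e f T ∈ U ∧
      -- the immanant is the element of `C` whose value at the identity matrix is `dim [π]`
      (∀ Q ∈ C, evalIdentity e f Q = (Module.finrank ℂ (specht T).toSubmodule : ℂ) ↔
        Q = immanant e f T) := by
  refine ⟨cauchySummand E F T, immanantLine e f T, isCopyOf_schurTensor_iff e f T,
    fun φ C' => ?_, Submodule.mem_span_singleton_self _, ?_, fun Q hQ => ?_⟩
  · rw [weightZeroImage_eq]
    exact isCopyOf_trivial_iff e f T C'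
  · obtain ⟨z, -, hz⟩ := immanant_mem_map_weightZeroTensor e f T
    exact ⟨z, hz⟩
  · obtain ⟨t, rfl⟩ := Submodule.mem_span_singleton.1 hQ
    -- On the line, evaluation at the identity is t ↦ t · dim [π] with dim [π] ≠ 0, which forces t =
    -- 1.
    rw [evalIdentity_smul, evalIdentity_immanant]
    refine ⟨fun h => ?_, fun h => ?_⟩
    · rw [(mul_eq_right₀ (finrank_specht_ne_zero T)).1 h, one_smul]
    · rw [← evalIdentity_immanant e f T, ← evalIdentity_smul, h]
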